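/- Let $V:\mathbb R^3\to\mathbb R$ be measurable, not almost everywhere zero, with $|\cdot|V\in L^\infty(\mathbb R^3)$. For $T,\mu>0$ let $K_{T,\mu}$ be the operator of multiplication in momentum space by $$K_{T,\mu}(p)=\frac{|p^2-\mu|}{\tanh\left(\frac{|p^2-\mu|}{2T}\right)}$$ (with the value $2T$ where $p^2=\mu$), and define the BCS critical temperature $$T_c(\mu)=\inf\{T>0 \mid K_{T,\mu}(p)+V(x)\ge 0\},$$ where $K_{T,\mu}(p)+V(x)\ge0$ is understood in the sense of quadratic forms on the form domain $H^1(\mathbb R^3)$ of $K_{T,\mu}$. Put $$C_2=\sqrt{\frac{\pi}{2\,\||\cdot|V\|_{L^\infty}}}.$$ Then for every $\mu_0>0$ there is a constant $C_1>0$, depending only on $V$ and $\mu_0$, such that for all $\mu\ge\mu_0$ the set in the definition of $T_c(\mu)$ is non-empty and $$T_c(\mu)\le C_1\,\mu\,\exp\left(-C_2\,\mu^{1/4}\right).$$ -/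

import Mathlib

open MeasureTheory
open scoped FourierTransform ENNReal

noncomputable section

/-- Position and momentum space `ℝ³` with the Euclidean norm. -/
abbrev R3 : Type := EuclideanSpace ℝ (Fin 3)

/-- The symbol `K_{T,μ}(p) = |p² - μ| / tanh (|p² - μ| / (2T))`; on the Fermi sphere `p² = μ`
it takes its limiting value `2T`. -/
def bcsSymbol (T μ : ℝ) (p : R3) : ℝ :=
  if ‖p‖ ^ 2 = μ then 2 * T
  else |‖p‖ ^ 2 - μ| / Real.tanh (|‖p‖ ^ 2 - μ| / (2 * T))

/-- The density in `ξ` of the kinetic form `⟨ψ, K_{T,μ}(-i∇) ψ⟩`. Mathlib's unitary Fourier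
transform has the kernel `exp (-2πi x·ξ)`, so the momentum is `p = 2πξ`. -/
def kineticDensity (T μ : ℝ) (ψ : Lp ℂ 2 (volume : Measure R3)) (ξ : R3) : ℝ :=
  bcsSymbol T μ ((2 * Real.pi) • ξ) * ‖(𝓕 ψ : Lp ℂ 2 (volume : Measure R3)) ξ‖ ^ 2

/-- The density in `x` of the potential form `⟨ψ, V ψ⟩`. -/
def potentialDensity (V : R3 → ℝ) (ψ : Lp ℂ 2 (volume : Measure R3)) (x : R3) : ℝ :=
  V x * ‖ψ x‖ ^ 2

/-- `K_{T,μ}(p) + V(x) ≥ 0` in the sense of quadratic forms: on the form domain of `K_{T,μ}`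
(which for `T > 0` is `H¹(ℝ³)`), the form of `V` is well defined and
`⟨ψ, (K_{T,μ} + V) ψ⟩ ≥ 0`. -/
def BCSNonneg (T μ : ℝ) (V : R3 → ℝ) : Prop :=
  ∀ ψ : Lp ℂ 2 (volume : Measure R3), Integrable (kineticDensity T μ ψ) →
    Integrable (potentialDensity V ψ) ∧
      0 ≤ (∫ ξ, kineticDensity T μ ψ ξ) + ∫ x, potentialDensity V ψ x

/-- The set of temperatures `T > 0` with `K_{T,μ}(p) + V(x) ≥ 0`. -/
def normalTemperatures (μ : ℝ) (V : R3 → ℝ) : Set ℝ :=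
  {T : ℝ | 0 < T ∧ BCSNonneg T μ V}

/-- The BCS critical temperature `T_c = inf {T > 0 | K_{T,μ}(p) + V(x) ≥ 0}`. -/
def criticalTemperature (μ : ℝ) (V : R3 → ℝ) : ℝ :=
  sInf (normalTemperatures μ V)

/-- The norm `‖ |·| V ‖_{L^∞(ℝ³)}`. -/
def weightedSupNorm (V : R3 → ℝ) : ℝ :=
  lpNorm (fun x : R3 => ‖x‖ * V x) ∞ volume

end

/-!
By Gaussian subordination `‖x‖ ^ (-2 * s)` is a superposition of Gaussians, so the quadratic form
of `‖x‖⁻¹` is dominated by the double integral of `|𝓕 ψ ξ| |𝓕 ψ η|` against the Riesz kernel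
`(π * ‖ξ - η‖ ^ 2)⁻¹`. The Schur test with weight `max (2 * T) |p² - μ| ≤ K_{T,μ}(p)` bounds this by
the kinetic form times the supremum over `ξ` of the integral of the Riesz kernel against the inverse
weight. That integral is radial: integrating over spheres first (Archimedes) leaves a
one-dimensional integral with a logarithmic kernel, which is at most
`2 * (log (μ / T) + 11) ^ 2 / (π * √μ)`. One logarithm comes from the kernel, the other from
`1 / |p² - μ|` near the Fermi sphere.

Consequently `K_{T,μ} + V ≥ 0` as soon as `2 * (log (μ / T) + 11) ^ 2 / (π * √μ) ≤ ‖|·|V‖_∞⁻¹`, that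
is, as soon as `T ≥ exp 11 * μ * exp (-C₂ * μ ^ (1 / 4))`. This requires `T ≤ μ`, so it covers large
`μ`; the remaining compact range of `μ` is absorbed into `C₁` by comparing with a larger `μ`.
-/

open Filter Topology

theorem lintegral_rpow_mul_exp_neg_mul {s t : ℝ} (hs : 0 < s) (ht : 0 < t) :
    ∫⁻ b in Set.Ioi (0 : ℝ), ENNReal.ofReal (b ^ (s - 1) * Real.exp (-(t * b))) =
      ENNReal.ofReal (Real.Gamma s * t ^ (-s)) := by
  have hint : IntegrableOn (fun b ↦ b ^ (s - 1) * Real.exp (-(t * b))) (Set.Ioi 0) := by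
    simpa using integrableOn_rpow_mul_exp_neg_mul_rpow (p := 1) (by linarith) one_pos ht
  rw [← ofReal_integral_eq_lintegral_ofReal hint,
    Real.integral_rpow_mul_exp_neg_mul_Ioi hs ht, one_div, Real.inv_rpow ht.le,
    ← Real.rpow_neg ht.le, mul_comm]
  filter_upwards [ae_restrict_mem measurableSet_Ioi] with b (hb : 0 < b)
  positivity

theorem lintegral_Ioi_comp_inv (g : ℝ → ℝ≥0∞) :
    ∫⁻ b in Set.Ioi (0 : ℝ), g b =
      ∫⁻ b in Set.Ioi (0 : ℝ), ENNReal.ofReal (b ^ (-2 : ℝ)) * g b⁻¹ := by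
  have himage : (·⁻¹) '' Set.Ioi (0 : ℝ) = Set.Ioi 0 := by
    ext b; simp [Set.image_inv_eq_inv]
  conv_lhs => rw [← himage]
  rw [lintegral_image_eq_lintegral_abs_deriv_mul measurableSet_Ioi
    (fun b (hb : 0 < b) ↦ (hasDerivAt_inv hb.ne').hasDerivWithinAt) inv_injective.injOn]
  refine setLIntegral_congr_fun measurableSet_Ioi fun b (hb : 0 < b) ↦ ?_
  rw [abs_neg, abs_of_pos (by positivity), Real.rpow_neg hb.le, Real.rpow_two]

theorem lintegral_rpow_mul_exp_neg_div {s t : ℝ} (hs : 0 < s) (ht : 0 < t) :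
    ∫⁻ b in Set.Ioi (0 : ℝ), ENNReal.ofReal (b ^ (-s - 1) * Real.exp (-(t / b))) =
      ENNReal.ofReal (Real.Gamma s * t ^ (-s)) := by
  rw [← lintegral_rpow_mul_exp_neg_mul hs ht, lintegral_Ioi_comp_inv]
  refine setLIntegral_congr_fun measurableSet_Ioi fun b (hb : 0 < b) ↦ ?_
  rw [← ENNReal.ofReal_mul (by positivity), Real.inv_rpow hb.le, ← Real.rpow_neg hb.le, ← mul_assoc,
    ← Real.rpow_add hb, div_inv_eq_mul]
  ring_nf

theorem lintegral_mul_exp_neg_mul_sq_eq_rpow {s t : ℝ} (hs : 0 < s) (ht : 0 < t) :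
    ∫⁻ b in Set.Ioi (0 : ℝ), ENNReal.ofReal (b ^ (s - 1) / Real.Gamma s) *
      ENNReal.ofReal (Real.exp (-b * t ^ 2)) = ENNReal.ofReal (t ^ (-(2 * s))) := by
  have hΓ := Real.Gamma_pos_of_pos hs
  calc _ = ∫⁻ b in Set.Ioi (0 : ℝ), ENNReal.ofReal (Real.Gamma s)⁻¹ *
        ENNReal.ofReal (b ^ (s - 1) * Real.exp (-(t ^ 2 * b))) := by
        refine setLIntegral_congr_fun measurableSet_Ioi fun b (hb : 0 < b) ↦ ?_
        rw [← ENNReal.ofReal_mul (by positivity), ← ENNReal.ofReal_mul (by positivity)]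
        ring_nf
    _ = _ := by
        rw [lintegral_const_mul' _ _ ENNReal.ofReal_ne_top,
          lintegral_rpow_mul_exp_neg_mul hs (by positivity), ← ENNReal.ofReal_mul (by positivity),
          inv_mul_cancel_left₀ hΓ.ne', ← Real.rpow_natCast, ← Real.rpow_mul ht.le, Nat.cast_ofNat,
          mul_neg]

theorem lintegral_lintegral_mul_swap {α β : Type*} [MeasurableSpace α] [MeasurableSpace β]
    {μ : Measure α} {ν : Measure β} [SFinite μ] [SFinite ν] {w : β → ℝ≥0∞} {k : β → α → ℝ≥0∞}
    {u : α → ℝ≥0∞} (hw : Measurable w) (hk : Measurable (Function.uncurry k)) (hu : Measurable u) :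
    ∫⁻ a, (∫⁻ b, w b * k b a ∂ν) * u a ∂μ = ∫⁻ b, w b * ∫⁻ a, k b a * u a ∂μ ∂ν := by
  have hk₁ (a : α) : Measurable fun b ↦ k b a := hk.comp measurable_prodMk_right
  have hk₂ (b : β) : Measurable fun a ↦ k b a := hk.comp measurable_prodMk_left
  calc ∫⁻ a, (∫⁻ b, w b * k b a ∂ν) * u a ∂μ = ∫⁻ a, ∫⁻ b, w b * (k b a * u a) ∂ν ∂μ := by
        refine lintegral_congr fun a ↦ ?_
        simp only [← mul_assoc]
        exact (lintegral_mul_const _ (hw.mul (hk₁ a))).symm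
    _ = ∫⁻ b, ∫⁻ a, w b * (k b a * u a) ∂μ ∂ν := lintegral_lintegral_swap (by fun_prop)
    _ = ∫⁻ b, w b * ∫⁻ a, k b a * u a ∂μ ∂ν :=
        lintegral_congr fun b ↦ lintegral_const_mul _ ((hk₂ b).mul hu)

section FourierInv

variable {E F : Type*} [NormedAddCommGroup E] [InnerProductSpace ℝ E] [FiniteDimensional ℝ E]
  [MeasurableSpace E] [BorelSpace E] [NormedAddCommGroup F]

theorem norm_fourierInv_le_integral_norm [NormedSpace ℂ F] (φ : E → F) (x : E) :
    ‖𝓕⁻ φ x‖ ≤ ∫ ξ, ‖φ ξ‖ :=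
  VectorFourier.norm_fourierIntegral_le_integral_norm Real.fourierChar volume (-innerₗ E) φ x

theorem continuous_fourierInv_of_integrable [NormedSpace ℂ F] {φ : E → F} (hφ : Integrable φ) :
    Continuous (𝓕⁻ φ) :=
  VectorFourier.fourierIntegral_continuous (L := -innerₗ E) Real.continuous_fourierChar
    (by simp only [LinearMap.neg_apply, innerₗ_apply_apply]; fun_prop) hφ

theorem integral_fourierInv_smul_eq [NormedSpace ℂ F] [CompleteSpace F] {g : E → ℂ} {φ : E → F}
    (hg : Integrable g) (hφ : Integrable φ) : ∫ ξ, 𝓕⁻ g ξ • φ ξ = ∫ x, g x • 𝓕⁻ φ x := by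
  have hflip : (-innerₗ E).flip = -innerₗ E := by ext x y; simp [real_inner_comm]
  simpa only [hflip] using! VectorFourier.integral_fourierIntegral_smul_eq_flip (L := -innerₗ E)
    Real.continuous_fourierChar
    (by simp only [LinearMap.neg_apply, innerₗ_apply_apply]; fun_prop) hg hφ

theorem fourier_smul_fourierInv [NormedSpace ℂ F] [CompleteSpace F] {g : E → ℂ} {φ : E → F}
    (hg : Integrable g) (hφ : Integrable φ) (ξ : E) :
    𝓕 (fun x ↦ g x • 𝓕⁻ φ x) ξ = ∫ η, 𝓕 g (ξ - η) • φ η := by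
  have hmod : Integrable fun x ↦ Real.fourierChar (-inner ℝ x ξ) • g x :=
    (Real.fourierIntegral_convergent_iff ξ).2 hg
  have htrans (η : E) :
      𝓕⁻ (fun x ↦ Real.fourierChar (-inner ℝ x ξ) • g x) η = 𝓕 g (ξ - η) := by
    rw [Real.fourierInv_eq, Real.fourier_eq]
    congr with x
    rw [smul_smul, ← AddChar.map_add_eq_mul, inner_sub_right]
    congr 2
    ring
  rw [Real.fourier_eq]
  simpa only [htrans, smul_assoc] using (integral_fourierInv_smul_eq hmod hφ).symm

theorem integral_inner_fourierInv_smul [InnerProductSpace ℂ F] [CompleteSpace F]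
    {g : E → ℂ} {φ : E → F} (hg : Integrable g) (hφ : Integrable φ) :
    ∫ x, inner ℂ (𝓕⁻ φ x) (g x • 𝓕⁻ φ x) =
      ∫ ξ, inner ℂ (φ ξ) (∫ η, 𝓕 g (ξ - η) • φ η) := by
  have hint : Integrable fun x ↦ g x • 𝓕⁻ φ x :=
    hg.smul_bdd _ (continuous_fourierInv_of_integrable hφ).aestronglyMeasurable
      (.of_forall (norm_fourierInv_le_integral_norm φ))
  simp_rw [← fourier_smul_fourierInv hg hφ]
  have hflip : -(-innerₗ E).flip = innerₗ E := by ext x y; simp [real_inner_comm]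
  simpa only [hflip] using! VectorFourier.integral_sesq_fourierIntegral_eq_neg_flip
    (L := -innerₗ E) (innerSL ℂ) Real.continuous_fourierChar
    (by simp only [LinearMap.neg_apply, innerₗ_apply_apply]; fun_prop) hφ hint

theorem lintegral_mul_enorm_fourierInv_sq_le [InnerProductSpace ℂ F] [CompleteSpace F]
    {g : E → ℝ} {φ : E → F} (hg : Integrable g) (hg₀ : ∀ x, 0 ≤ g x) (hφ : Integrable φ) :
    ∫⁻ x, ENNReal.ofReal (g x) * ‖𝓕⁻ φ x‖ₑ ^ 2 ≤
      ∫⁻ ξ, ∫⁻ η, ‖𝓕 (fun x ↦ (g x : ℂ)) (ξ - η)‖ₑ * (‖φ ξ‖ₑ * ‖φ η‖ₑ) := by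
  have hgC : Integrable fun x ↦ (g x : ℂ) := hg.ofReal
  have hcont := continuous_fourierInv_of_integrable hφ
  have hint : Integrable fun x ↦ g x * ‖𝓕⁻ φ x‖ ^ 2 :=
    hg.mul_bdd (c := (∫ ξ, ‖φ ξ‖) ^ 2) (by fun_prop) (.of_forall fun x ↦ by
      rw [norm_pow, norm_norm]; gcongr; exact norm_fourierInv_le_integral_norm φ x)
  have hnonneg (x : E) : 0 ≤ g x * ‖𝓕⁻ φ x‖ ^ 2 := mul_nonneg (hg₀ x) (by positivity)
  have hinner (x : E) : inner ℂ (𝓕⁻ φ x) ((g x : ℂ) • 𝓕⁻ φ x) =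
      ((g x * ‖𝓕⁻ φ x‖ ^ 2 : ℝ) : ℂ) := by
    rw [inner_smul_right, inner_self_eq_norm_sq_to_K]
    push_cast
    rfl
  calc ∫⁻ x, ENNReal.ofReal (g x) * ‖𝓕⁻ φ x‖ₑ ^ 2
      = ∫⁻ x, ENNReal.ofReal (g x * ‖𝓕⁻ φ x‖ ^ 2) := by
        simp_rw [ENNReal.ofReal_mul (hg₀ _), ENNReal.ofReal_pow (norm_nonneg _), ofReal_norm]
    _ = ENNReal.ofReal (∫ x, g x * ‖𝓕⁻ φ x‖ ^ 2) :=
        (ofReal_integral_eq_lintegral_ofReal hint (.of_forall hnonneg)).symm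
    _ = ‖∫ x, inner ℂ (𝓕⁻ φ x) ((g x : ℂ) • 𝓕⁻ φ x)‖ₑ := by
        simp_rw [hinner]
        rw [integral_complex_ofReal, ← ofReal_norm, Complex.norm_real,
          Real.norm_of_nonneg (integral_nonneg hnonneg)]
    _ = ‖∫ ξ, inner ℂ (φ ξ) (∫ η, 𝓕 (fun x ↦ (g x : ℂ)) (ξ - η) • φ η)‖ₑ := by
        rw [integral_inner_fourierInv_smul hgC hφ]
    _ ≤ ∫⁻ ξ, ‖inner ℂ (φ ξ) (∫ η, 𝓕 (fun x ↦ (g x : ℂ)) (ξ - η) • φ η)‖ₑ :=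
        enorm_integral_le_lintegral_enorm _
    _ ≤ _ := lintegral_mono fun ξ ↦ ?_
  calc ‖inner ℂ (φ ξ) (∫ η, 𝓕 (fun x ↦ (g x : ℂ)) (ξ - η) • φ η)‖ₑ
      ≤ ‖φ ξ‖ₑ * ‖∫ η, 𝓕 (fun x ↦ (g x : ℂ)) (ξ - η) • φ η‖ₑ := by
        simpa only [← ofReal_norm, ← ENNReal.ofReal_mul (norm_nonneg _)] using
          ENNReal.ofReal_le_ofReal (norm_inner_le_norm _ _)
    _ ≤ ‖φ ξ‖ₑ * ∫⁻ η, ‖𝓕 (fun x ↦ (g x : ℂ)) (ξ - η) • φ η‖ₑ := by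
        gcongr; exact enorm_integral_le_lintegral_enorm _
    _ = _ := by
        rw [← lintegral_const_mul' _ _ enorm_ne_top]
        refine lintegral_congr fun η ↦ ?_
        rw [enorm_smul, mul_left_comm]

theorem fourierInv_toLp_ae_eq [InnerProductSpace ℂ F] [CompleteSpace F] {φ : E → F}
    (hφ : Integrable φ) (hφ₂ : MemLp φ 2) :
    ((𝓕⁻ (hφ₂.toLp φ) : Lp F 2 (volume : Measure E)) : E → F) =ᵐ[volume] 𝓕⁻ φ := by
  refine ae_eq_of_integral_contDiff_smul_eq ((Lp.memLp _).locallyIntegrable one_le_two)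
    (continuous_fourierInv_of_integrable hφ).locallyIntegrable fun g hg hg_supp ↦ ?_
  have hG_supp : HasCompactSupport (Complex.ofRealCLM ∘ g) := hg_supp.comp_left rfl
  set G := hG_supp.toSchwartzMap (Complex.ofRealCLM.contDiff.comp hg) with hG
  have hGg (x : E) (y : F) : G x • y = g x • y := by simp [hG, Complex.coe_smul]
  have hdistr := DFunLike.congr_fun (Lp.fourierInv_toTemperedDistribution_eq (hφ₂.toLp φ)) G
  simp only [TemperedDistribution.fourierInv_apply, Lp.toTemperedDistribution_apply] at hdistr
  calc ∫ x, g x • (𝓕⁻ (hφ₂.toLp φ) : Lp F 2 (volume : Measure E)) x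
      = ∫ x, (𝓕⁻ G) x • (hφ₂.toLp φ) x := by simp only [hdistr, hGg]
    _ = ∫ x, (𝓕⁻ G) x • φ x :=
        integral_congr_ae (hφ₂.coeFn_toLp.mono fun x hx ↦ by simp only [hx])
    _ = ∫ x, g x • 𝓕⁻ φ x := by
        simp only [SchwartzMap.fourierInv_coe, integral_fourierInv_smul_eq G.integrable hφ, hGg]

end FourierInv

section RieszPotential

variable {E F : Type*} [NormedAddCommGroup E] [InnerProductSpace ℝ E]

/-- The Riesz kernel on a `d`-dimensional space `E`, normalised (for the Fourier transform with
kernel `exp (-2πi⟨x, ξ⟩)`) so that it is the Fourier transform of `x ↦ ‖x‖ ^ (-2s)` when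
`0 < s < d / 2`. -/
noncomputable def rieszKernel (s : ℝ) (ζ : E) : ℝ :=
  Real.pi ^ (Module.finrank ℝ E / 2 : ℝ) / Real.Gamma s *
    (Real.Gamma (Module.finrank ℝ E / 2 - s) *
      (Real.pi ^ 2 * ‖ζ‖ ^ 2) ^ (-(Module.finrank ℝ E / 2 - s)))

theorem measurable_rieszKernel [MeasurableSpace E] [OpensMeasurableSpace E] (s : ℝ) :
    Measurable (rieszKernel s : E → ℝ) := by
  unfold rieszKernel
  fun_prop

theorem rieszKernel_neg (s : ℝ) (ζ : E) : rieszKernel s (-ζ) = rieszKernel s ζ := by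
  simp only [rieszKernel, norm_neg]

theorem lintegral_mul_fourier_gaussian_eq_rieszKernel {s : ℝ} (hs : 0 < s)
    (hsd : s < Module.finrank ℝ E / 2) {ζ : E} (hζ : ζ ≠ 0) :
    ∫⁻ b in Set.Ioi (0 : ℝ), ENNReal.ofReal (b ^ (s - 1) / Real.Gamma s) *
      ENNReal.ofReal ((Real.pi / b) ^ (Module.finrank ℝ E / 2 : ℝ) *
        Real.exp (-(Real.pi ^ 2 * ‖ζ‖ ^ 2 / b))) = ENNReal.ofReal (rieszKernel s ζ) := by
  have hζ' : 0 < Real.pi ^ 2 * ‖ζ‖ ^ 2 := by positivity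
  set d : ℝ := (Module.finrank ℝ E : ℝ)
  calc _ = ∫⁻ b in Set.Ioi (0 : ℝ), ENNReal.ofReal (Real.pi ^ (d / 2) / Real.Gamma s) *
        ENNReal.ofReal (b ^ (-(d / 2 - s) - 1) * Real.exp (-(Real.pi ^ 2 * ‖ζ‖ ^ 2 / b))) := by
        refine setLIntegral_congr_fun measurableSet_Ioi fun b (hb : 0 < b) ↦ ?_
        have hpow : b ^ (-(d / 2 - s) - 1) = b ^ (s - 1) / b ^ (d / 2) := by
          rw [← Real.rpow_sub hb]; ring_nf
        rw [← ENNReal.ofReal_mul (by positivity), ← ENNReal.ofReal_mul (by positivity), hpow,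
          Real.div_rpow Real.pi_pos.le hb.le]
        ring_nf
    _ = _ := by
        rw [lintegral_const_mul' _ _ ENNReal.ofReal_ne_top,
          lintegral_rpow_mul_exp_neg_div (sub_pos.2 hsd) hζ', ← ENNReal.ofReal_mul (by positivity),
          rieszKernel]

variable [FiniteDimensional ℝ E] [MeasurableSpace E] [BorelSpace E] [NormedAddCommGroup F]
  [InnerProductSpace ℂ F] [CompleteSpace F]

theorem integrable_gaussian {b : ℝ} (hb : 0 < b) :
    Integrable fun x : E ↦ Real.exp (-b * ‖x‖ ^ 2) := by
  simpa [← Complex.ofReal_exp, ← Complex.ofReal_pow, ← Complex.ofReal_mul, ← Complex.ofReal_neg]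
    using (GaussianFourier.integrable_cexp_neg_mul_sq_norm_add (V := E) (b := b)
      (by simpa using hb) 0 0).re

theorem enorm_fourier_gaussian {b : ℝ} (hb : 0 < b) (ζ : E) :
    ‖𝓕 (fun x : E ↦ (Real.exp (-b * ‖x‖ ^ 2) : ℂ)) ζ‖ₑ =
      ENNReal.ofReal ((Real.pi / b) ^ (Module.finrank ℝ E / 2 : ℝ) *
        Real.exp (-(Real.pi ^ 2 * ‖ζ‖ ^ 2 / b))) := by
  have hfun : (fun x : E ↦ (Real.exp (-b * ‖x‖ ^ 2) : ℂ)) = fun x ↦ Complex.exp (-b * ‖x‖ ^ 2) := by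
    ext x; push_cast; rfl
  have hexp : -(Real.pi : ℂ) ^ 2 * ‖ζ‖ ^ 2 / b = (-(Real.pi ^ 2 * ‖ζ‖ ^ 2 / b) : ℝ) := by
    push_cast; ring
  rw [hfun, fourier_gaussian_innerProductSpace (by simpa using hb), hexp, ← ofReal_norm, norm_mul,
    ← Complex.ofReal_div, Complex.norm_cpow_eq_rpow_re_of_pos (by positivity), Complex.norm_exp,
    Complex.ofReal_re]
  simp

/-- The Gaussian subordination `‖x‖ ^ (-2s) = Γ(s)⁻¹ ∫₀^∞ b ^ (s - 1) exp (-b‖x‖²) db` avoids the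
distributional Fourier transform of `‖x‖ ^ (-2s)`. -/
theorem lintegral_rpow_norm_mul_enorm_fourierInv_sq_le {s : ℝ} (hs : 0 < s)
    (hsd : s < Module.finrank ℝ E / 2) {φ : E → F} (hφ : Integrable φ)
    (hφm : StronglyMeasurable φ) :
    ∫⁻ x : E, ENNReal.ofReal (‖x‖ ^ (-(2 * s))) * ‖𝓕⁻ φ x‖ₑ ^ 2 ≤
      ∫⁻ ξ, ∫⁻ η, ENNReal.ofReal (rieszKernel s (ξ - η)) * (‖φ ξ‖ₑ * ‖φ η‖ₑ) := by
  have : Nontrivial E := Module.nontrivial_of_finrank_pos (R := ℝ) (by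
    have : (0 : ℝ) < Module.finrank ℝ E := by linarith
    exact_mod_cast this)
  have : Measurable fun ξ ↦ ‖φ ξ‖ₑ := hφm.enorm
  set w : ℝ → ℝ≥0∞ := fun b ↦ ENNReal.ofReal (b ^ (s - 1) / Real.Gamma s)
  have hw : Measurable w := by fun_prop
  set G : ℝ → E → ℝ≥0∞ := fun b ζ ↦ ENNReal.ofReal
    ((Real.pi / b) ^ (Module.finrank ℝ E / 2 : ℝ) * Real.exp (-(Real.pi ^ 2 * ‖ζ‖ ^ 2 / b)))
  calc
    _ = ∫⁻ x : E, (∫⁻ b in Set.Ioi (0 : ℝ), w b * ENNReal.ofReal (Real.exp (-b * ‖x‖ ^ 2))) *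
          ‖𝓕⁻ φ x‖ₑ ^ 2 := by
        refine lintegral_congr_ae ((Measure.ae_ne volume 0).mono fun x hx ↦ ?_)
        simp only [w, lintegral_mul_exp_neg_mul_sq_eq_rpow hs (norm_pos_iff.2 hx)]
    _ = ∫⁻ b in Set.Ioi (0 : ℝ),
          w b * ∫⁻ x : E, ENNReal.ofReal (Real.exp (-b * ‖x‖ ^ 2)) * ‖𝓕⁻ φ x‖ₑ ^ 2 :=
        lintegral_lintegral_mul_swap hw (by fun_prop)
          ((continuous_fourierInv_of_integrable hφ).enorm.measurable.pow_const 2)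
    _ ≤ ∫⁻ b in Set.Ioi (0 : ℝ), w b * ∫⁻ ξ, ∫⁻ η, G b (ξ - η) * (‖φ ξ‖ₑ * ‖φ η‖ₑ) := by
        refine setLIntegral_mono' measurableSet_Ioi fun b hb ↦ mul_le_mul_right ?_ _
        simp only [G, ← enorm_fourier_gaussian hb]
        exact lintegral_mul_enorm_fourierInv_sq_le (integrable_gaussian hb)
          (fun _ ↦ (Real.exp_pos _).le) hφ
    _ = ∫⁻ b in Set.Ioi (0 : ℝ),
          w b * ∫⁻ p : E × E, G b (p.1 - p.2) * (‖φ p.1‖ₑ * ‖φ p.2‖ₑ) :=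
        lintegral_congr fun b ↦ by
          rw [lintegral_lintegral (by fun_prop), Measure.volume_eq_prod]
    _ = ∫⁻ p : E × E, (∫⁻ b in Set.Ioi (0 : ℝ), w b * G b (p.1 - p.2)) *
          (‖φ p.1‖ₑ * ‖φ p.2‖ₑ) :=
        (lintegral_lintegral_mul_swap hw (by fun_prop) (by fun_prop)).symm
    _ = ∫⁻ ξ, ∫⁻ η, (∫⁻ b in Set.Ioi (0 : ℝ), w b * G b (ξ - η)) * (‖φ ξ‖ₑ * ‖φ η‖ₑ) := by
        rw [lintegral_lintegral (Measurable.aemeasurable (by fun_prop)), Measure.volume_eq_prod]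
    _ = _ := by
        refine lintegral_congr fun ξ ↦ lintegral_congr_ae ?_
        filter_upwards [Measure.ae_ne volume ξ] with η hη
        rw [lintegral_mul_fourier_gaussian_eq_rieszKernel hs hsd (sub_ne_zero.2 hη.symm)]

end RieszPotential

section SchurTest

theorem two_mul_mul_le_sq_mul_add_sq_mul_inv (a b : ℝ≥0∞) {t : ℝ≥0∞} (ht₀ : t ≠ 0) (ht : t ≠ ∞) :
    2 * (a * b) ≤ a ^ 2 * t + b ^ 2 * t⁻¹ := by
  rcases eq_or_ne a ∞ with rfl | ha
  · simp [ENNReal.top_mul ht₀]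
  rcases eq_or_ne b ∞ with rfl | hb
  · simp [ENNReal.top_mul (ENNReal.inv_ne_zero.2 ht)]
  lift a to NNReal using ha
  lift b to NNReal using hb
  lift t to NNReal using ht
  have ht' : t ≠ 0 := by simpa using ht₀
  rw [← ENNReal.coe_inv ht']
  norm_cast
  have hsqrt : NNReal.sqrt t ≠ 0 := by simpa using ht'
  have h := two_mul_le_add_sq (a * NNReal.sqrt t) (b * (NNReal.sqrt t)⁻¹)
  rw [mul_pow, mul_pow, inv_pow, NNReal.sq_sqrt, mul_assoc] at h
  convert h using 2
  field_simp

variable {α : Type*} [MeasurableSpace α] {μ : Measure α} [SFinite μ]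

theorem lintegral_lintegral_add_swap {A : α → α → ℝ≥0∞} (hA : Measurable (Function.uncurry A)) :
    ∫⁻ x, ∫⁻ y, (A x y + A y x) ∂μ ∂μ = 2 * ∫⁻ x, ∫⁻ y, A x y ∂μ ∂μ := by
  have hswap : ∫⁻ x, ∫⁻ y, A y x ∂μ ∂μ = ∫⁻ x, ∫⁻ y, A x y ∂μ ∂μ :=
    lintegral_lintegral_swap (hA.comp measurable_swap).aemeasurable
  have hinner : Measurable fun x ↦ ∫⁻ y, A x y ∂μ := hA.lintegral_prod_right'
  calc ∫⁻ x, ∫⁻ y, (A x y + A y x) ∂μ ∂μ = ∫⁻ x, (∫⁻ y, A x y ∂μ + ∫⁻ y, A y x ∂μ) ∂μ :=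
        lintegral_congr fun x ↦ lintegral_add_left (hA.comp measurable_prodMk_left) _
    _ = 2 * ∫⁻ x, ∫⁻ y, A x y ∂μ ∂μ := by rw [lintegral_add_left hinner, hswap, two_mul]

/-- By AM-GM, `2 * (f x * f y) ≤ f x ^ 2 * (w x / w y) + f y ^ 2 * (w y / w x)`. -/
theorem lintegral_lintegral_mul_le_of_schur {k : α → α → ℝ≥0∞} {w f : α → ℝ≥0∞} {c : ℝ≥0∞}
    (hk : Measurable (Function.uncurry k)) (hk_symm : ∀ x y, k x y = k y x)
    (hw : Measurable w) (hw₀ : ∀ x, w x ≠ 0) (hw_top : ∀ x, w x ≠ ∞) (hf : Measurable f)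
    (hschur : ∀ᵐ x ∂μ, ∫⁻ y, k x y * (w y)⁻¹ ∂μ ≤ c) :
    ∫⁻ x, ∫⁻ y, k x y * (f x * f y) ∂μ ∂μ ≤ c * ∫⁻ x, w x * f x ^ 2 ∂μ := by
  set A : α → α → ℝ≥0∞ := fun x y ↦ k x y * (f x ^ 2 * (w x * (w y)⁻¹)) with hA
  have hAm : Measurable (Function.uncurry A) :=
    hk.mul (((hf.comp measurable_fst).pow_const 2).mul
      ((hw.comp measurable_fst).mul (hw.comp measurable_snd).inv))
  have hA_le : ∫⁻ x, ∫⁻ y, A x y ∂μ ∂μ ≤ c * ∫⁻ x, w x * f x ^ 2 ∂μ := by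
    rw [← lintegral_const_mul _ (by fun_prop)]
    refine lintegral_mono_ae (hschur.mono fun x hx ↦ ?_)
    calc ∫⁻ y, A x y ∂μ = ∫⁻ y, w x * f x ^ 2 * (k x y * (w y)⁻¹) ∂μ :=
          lintegral_congr fun y ↦ by simp only [hA]; ring
      _ = w x * f x ^ 2 * ∫⁻ y, k x y * (w y)⁻¹ ∂μ :=
          lintegral_const_mul _ ((hk.comp measurable_prodMk_left).mul hw.inv)
      _ ≤ c * (w x * f x ^ 2) := by rw [mul_comm c]; gcongr
  have hsymm_le (x y : α) : 2 * (k x y * (f x * f y)) ≤ A x y + A y x := by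
    have h := two_mul_mul_le_sq_mul_add_sq_mul_inv (f x) (f y)
      (mul_ne_zero (hw₀ x) (ENNReal.inv_ne_zero.2 (hw_top y)))
      (ENNReal.mul_ne_top (hw_top x) (ENNReal.inv_ne_top.2 (hw₀ y)))
    rw [ENNReal.mul_inv (.inl (hw₀ x)) (.inl (hw_top x)), inv_inv, mul_comm (w x)⁻¹] at h
    rw [mul_left_comm]
    simp only [hA, hk_symm y x, ← mul_add]
    gcongr
  rw [← ENNReal.mul_le_mul_iff_right (a := 2) (by simp) (by simp)]
  calc 2 * ∫⁻ x, ∫⁻ y, k x y * (f x * f y) ∂μ ∂μ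
      = ∫⁻ x, ∫⁻ y, 2 * (k x y * (f x * f y)) ∂μ ∂μ := by
        simp_rw [lintegral_const_mul' 2 _ ENNReal.ofNat_ne_top]
    _ ≤ ∫⁻ x, ∫⁻ y, (A x y + A y x) ∂μ ∂μ :=
        lintegral_mono fun x ↦ lintegral_mono fun y ↦ hsymm_le x y
    _ = 2 * ∫⁻ x, ∫⁻ y, A x y ∂μ ∂μ := lintegral_lintegral_add_swap hAm
    _ ≤ 2 * (c * ∫⁻ x, w x * f x ^ 2 ∂μ) := mul_le_mul_right hA_le 2

end SchurTest

theorem exists_seq_indicator_toLp_tendsto {α F : Type*} [MeasurableSpace α] {μ : Measure α}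
    [NormedAddCommGroup F] {p : ℝ≥0∞} [Fact (1 ≤ p)] (hp : p ≠ ∞) (f : Lp F p μ) :
    ∃ (s : ℕ → Set α) (hs : ∀ n, MeasurableSet (s n)), (∀ n, μ (s n) < ∞) ∧
      Tendsto (fun n ↦ ((Lp.memLp f).indicator (hs n)).toLp _) atTop (𝓝 f) := by
  choose s hs hμs hsf using fun n : ℕ ↦
    (Lp.memLp f).exists_eLpNorm_indicator_compl_lt hp (ε := (n : ℝ≥0∞)⁻¹) (by simp)
  refine ⟨s, hs, hμs, ?_⟩
  conv in 𝓝 f => rw [← Lp.toLp_coeFn f (Lp.memLp f)]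
  rw [Lp.tendsto_Lp_iff_tendsto_eLpNorm'']
  refine tendsto_of_tendsto_of_tendsto_of_le_of_le tendsto_const_nhds
    ENNReal.tendsto_inv_nat_nhds_zero (fun _ ↦ zero_le) fun n ↦ ?_
  rw [← eLpNorm_neg, neg_sub, ← Set.indicator_compl]
  exact (hsf n).le

section HerbstInequality

variable {E F : Type*} [NormedAddCommGroup E] [InnerProductSpace ℝ E] [FiniteDimensional ℝ E]
  [MeasurableSpace E] [BorelSpace E] [NormedAddCommGroup F] [InnerProductSpace ℂ F]
  [CompleteSpace F]

theorem exists_seq_fourierInv_tendsto_ae (ψ : Lp F 2 (volume : Measure E)) :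
    ∃ φ : ℕ → E → F, (∀ n, Integrable (φ n)) ∧ (∀ n, StronglyMeasurable (φ n)) ∧
      (∀ n ξ, ‖φ n ξ‖ₑ ≤ ‖(𝓕 ψ : Lp F 2 (volume : Measure E)) ξ‖ₑ) ∧
      ∀ᵐ x, Tendsto (fun n ↦ 𝓕⁻ (φ n) x) atTop (𝓝 (ψ x)) := by
  obtain ⟨s, hs, hμs, hlim⟩ := exists_seq_indicator_toLp_tendsto ENNReal.ofNat_ne_top
    (𝓕 ψ : Lp F 2 (volume : Measure E))
  have hmem (n : ℕ) := (Lp.memLp (𝓕 ψ : Lp F 2 (volume : Measure E))).indicator (hs n)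
  have hint (n : ℕ) : Integrable ((s n).indicator (𝓕 ψ : Lp F 2 (volume : Measure E))) := by
    have : IsFiniteMeasure (volume.restrict (s n)) := isFiniteMeasure_restrict.2 (hμs n).ne
    exact (integrable_indicator_iff (hs n)).2
      (((Lp.memLp _).restrict (s n)).integrable one_le_two)
  have hlim_inv : Tendsto (fun n ↦ (𝓕⁻ ((hmem n).toLp _) : Lp F 2 (volume : Measure E))) atTop
      (𝓝 ψ) := by
    simpa only [Function.comp_def, FourierTransform.fourierInv_fourier_eq] using
      ((FourierTransform.continuous_fourierInv (E := Lp F 2 (volume : Measure E))).tendsto _).comp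
        hlim
  obtain ⟨ns, -, hns⟩ := (tendstoInMeasure_of_tendsto_Lp hlim_inv).exists_seq_tendsto_ae
  refine ⟨fun n ↦ (s (ns n)).indicator (𝓕 ψ : Lp F 2 (volume : Measure E)), fun n ↦ hint _,
    fun n ↦ (Lp.stronglyMeasurable _).indicator (hs _),
    fun n ξ ↦ enorm_indicator_le_enorm_self _ _, ?_⟩
  filter_upwards [hns, ae_all_iff.2 fun n ↦ fourierInv_toLp_ae_eq (hint n) (hmem n)] with x hx hx'
  exact hx.congr fun n ↦ hx' (ns n)

theorem lintegral_rpow_norm_mul_enorm_sq_le_of_schur {s : ℝ} (hs : 0 < s)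
    (hsd : s < Module.finrank ℝ E / 2) {w : E → ℝ≥0∞} (hw : Measurable w) (hw₀ : ∀ ξ, w ξ ≠ 0)
    (hw_top : ∀ ξ, w ξ ≠ ∞) {c : ℝ≥0∞}
    (hschur : ∀ᵐ ξ : E, ∫⁻ η, ENNReal.ofReal (rieszKernel s (ξ - η)) * (w η)⁻¹ ≤ c)
    (ψ : Lp F 2 (volume : Measure E)) :
    ∫⁻ x : E, ENNReal.ofReal (‖x‖ ^ (-(2 * s))) * ‖ψ x‖ₑ ^ 2 ≤
      c * ∫⁻ ξ, w ξ * ‖(𝓕 ψ : Lp F 2 (volume : Measure E)) ξ‖ₑ ^ 2 := by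
  obtain ⟨φ, hφ, hφm, hφ_le, hφ_lim⟩ := exists_seq_fourierInv_tendsto_ae ψ
  have hk : Measurable fun p : E × E ↦ ENNReal.ofReal (rieszKernel s (p.1 - p.2)) :=
    ((measurable_rieszKernel s).comp (by fun_prop)).ennreal_ofReal
  have hbound (n : ℕ) : ∫⁻ x : E, ENNReal.ofReal (‖x‖ ^ (-(2 * s))) * ‖𝓕⁻ (φ n) x‖ₑ ^ 2 ≤
      c * ∫⁻ ξ, w ξ * ‖(𝓕 ψ : Lp F 2 (volume : Measure E)) ξ‖ₑ ^ 2 := calc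
    _ ≤ ∫⁻ ξ, ∫⁻ η, ENNReal.ofReal (rieszKernel s (ξ - η)) * (‖φ n ξ‖ₑ * ‖φ n η‖ₑ) :=
      lintegral_rpow_norm_mul_enorm_fourierInv_sq_le hs hsd (hφ n) (hφm n)
    _ ≤ c * ∫⁻ ξ, w ξ * ‖φ n ξ‖ₑ ^ 2 :=
      lintegral_lintegral_mul_le_of_schur hk (fun ξ η ↦ by rw [← neg_sub, rieszKernel_neg])
        hw hw₀ hw_top (hφm n).enorm hschur
    _ ≤ _ := by gcongr with ξ; exact hφ_le n ξ
  calc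
    _ = ∫⁻ x : E, liminf (fun n ↦ ENNReal.ofReal (‖x‖ ^ (-(2 * s))) * ‖𝓕⁻ (φ n) x‖ₑ ^ 2) atTop := by
      refine lintegral_congr_ae (hφ_lim.mono fun x hx ↦ (Tendsto.liminf_eq ?_).symm)
      exact ENNReal.Tendsto.const_mul (((ENNReal.continuous_pow 2).tendsto _).comp hx.enorm)
        (.inr ENNReal.ofReal_ne_top)
    _ ≤ liminf (fun n ↦ ∫⁻ x : E, ENNReal.ofReal (‖x‖ ^ (-(2 * s))) * ‖𝓕⁻ (φ n) x‖ₑ ^ 2) atTop :=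
      lintegral_liminf_le fun n ↦ Measurable.mul (by fun_prop)
        ((continuous_fourierInv_of_integrable (hφ n)).enorm.measurable.pow_const 2)
    _ ≤ _ := liminf_le_of_frequently_le' (.of_forall hbound)

end HerbstInequality

theorem rieszKernel_half (ζ : R3) : rieszKernel (1 / 2) ζ = (Real.pi * ‖ζ‖ ^ 2)⁻¹ := by
  have hpow : Real.pi ^ (3 / 2 : ℝ) = Real.pi * √Real.pi := by
    rw [Real.sqrt_eq_rpow, ← Real.rpow_one_add' Real.pi_pos.le (by norm_num)]
    norm_num
  have hpi : √Real.pi ≠ 0 := (Real.sqrt_pos.2 Real.pi_pos).ne'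
  rw [rieszKernel, finrank_euclideanSpace_fin, Nat.cast_ofNat, hpow, Real.Gamma_one_half_eq,
    show (3 / 2 - 1 / 2 : ℝ) = 1 by norm_num, Real.Gamma_one, Real.rpow_neg_one]
  have := Real.pi_ne_zero
  field_simp

section RadialIntegrals

theorem lintegral_Ioi_zero_eq_lintegral_sq_sub_sq (g : ℝ → ℝ≥0∞) {a : ℝ} (ha : 0 ≤ a) :
    ∫⁻ t in Set.Ioi (0 : ℝ), g t =
      ∫⁻ r in Set.Ioi a, ENNReal.ofReal (2 * r) * g (r ^ 2 - a ^ 2) := by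
  have himage : (fun r : ℝ ↦ r ^ 2 - a ^ 2) '' Set.Ioi a = Set.Ioi 0 := by
    ext t
    simp only [Set.mem_image, Set.mem_Ioi]
    refine ⟨?_, fun ht ↦ ⟨√(t + a ^ 2), Real.lt_sqrt_of_sq_lt (by linarith), ?_⟩⟩
    · rintro ⟨r, hr, rfl⟩
      nlinarith
    · rw [Real.sq_sqrt (by positivity), add_sub_cancel_right]
  rw [← himage]
  refine lintegral_image_eq_lintegral_deriv_mul_of_monotoneOn measurableSet_Ioi
    (fun r _ ↦ ?_) (fun r hr s _ hrs ↦ ?_) g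
  · simpa using ((hasDerivAt_pow 2 r).sub_const (a ^ 2)).hasDerivWithinAt
  · rw [Set.mem_Ioi] at hr
    nlinarith

theorem lintegral_sq_add_sq {h : ℝ → ℝ≥0∞} (hh : Measurable h) :
    ∫⁻ p : ℝ × ℝ, h (p.1 ^ 2 + p.2 ^ 2) =
      ENNReal.ofReal Real.pi * ∫⁻ t in Set.Ioi (0 : ℝ), h t := by
  have hpolar (p : ℝ × ℝ) :
      (polarCoord.symm p).1 ^ 2 + (polarCoord.symm p).2 ^ 2 = p.1 ^ 2 := by
    rw [polarCoord_symm_apply]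
    linear_combination p.1 ^ 2 * Real.cos_sq_add_sin_sq p.2
  have hangle : volume (Set.Ioo (-Real.pi) Real.pi) = 2 * ENNReal.ofReal Real.pi := by
    rw [Real.volume_Ioo, sub_neg_eq_add, ← two_mul, ENNReal.ofReal_mul (by norm_num),
      ENNReal.ofReal_ofNat]
  rw [← lintegral_comp_polarCoord_symm, lintegral_Ioi_zero_eq_lintegral_sq_sub_sq h le_rfl]
  simp only [hpolar, polarCoord_target, smul_eq_mul]
  rw [Measure.volume_eq_prod, ← Measure.prod_restrict,
    lintegral_prod _ (Measurable.aemeasurable (by fun_prop)),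
    ← lintegral_const_mul' _ _ ENNReal.ofReal_ne_top]
  refine lintegral_congr fun r ↦ ?_
  dsimp only
  rw [lintegral_const, Measure.restrict_apply_univ, hangle, ENNReal.ofReal_mul (by norm_num),
    ENNReal.ofReal_ofNat, zero_pow two_ne_zero, sub_zero]
  ring

theorem lintegral_euclideanSpace_fin_three {H : ℝ → ℝ → ℝ≥0∞}
    (hH : Measurable (Function.uncurry H)) :
    ∫⁻ q : EuclideanSpace ℝ (Fin 3), H (q 0) (q 1 ^ 2 + q 2 ^ 2) =
      ENNReal.ofReal Real.pi * ∫⁻ z : ℝ, ∫⁻ t in Set.Ioi (0 : ℝ), H z t := by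
  have hsplit := ((MeasurePreserving.id (volume : Measure ℝ)).prod
    (volume_preserving_finTwoArrow ℝ)).comp
    ((volume_preserving_piFinSuccAbove (fun _ : Fin 3 ↦ ℝ) 0).comp
      (PiLp.volume_preserving_ofLp (Fin 3)))
  have hHp : Measurable fun p : ℝ × ℝ × ℝ ↦ H p.1 (p.2.1 ^ 2 + p.2.2 ^ 2) :=
    hH.comp (by fun_prop : Measurable fun p : ℝ × ℝ × ℝ ↦ (p.1, p.2.1 ^ 2 + p.2.2 ^ 2))
  calc _ = ∫⁻ p : ℝ × ℝ × ℝ, H p.1 (p.2.1 ^ 2 + p.2.2 ^ 2) := hsplit.lintegral_comp hHp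
    _ = ∫⁻ z : ℝ, ∫⁻ p : ℝ × ℝ, H z (p.1 ^ 2 + p.2 ^ 2) := lintegral_prod _ hHp.aemeasurable
    _ = ∫⁻ z : ℝ, ENNReal.ofReal Real.pi * ∫⁻ t in Set.Ioi (0 : ℝ), H z t :=
        lintegral_congr fun z ↦ lintegral_sq_add_sq (hH.comp measurable_prodMk_left)
    _ = _ := lintegral_const_mul' _ _ ENNReal.ofReal_ne_top

theorem lintegral_lintegral_Ioi_abs_swap {K : ℝ → ℝ → ℝ≥0∞}
    (hK : Measurable (Function.uncurry K)) :
    ∫⁻ z : ℝ, ∫⁻ r in Set.Ioi |z|, K r z =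
      ∫⁻ r in Set.Ioi (0 : ℝ), ∫⁻ z in Set.Ioo (-r) r, K r z := by
  set S : Set (ℝ × ℝ) := {q | |q.2| < q.1} with hS
  have hSm : MeasurableSet S := measurableSet_lt (by fun_prop) (by fun_prop)
  have hslice (r : ℝ) : ∫⁻ z : ℝ, S.indicator (Function.uncurry K) (r, z) =
      ∫⁻ z in Set.Ioo (-r) r, K r z := by
    rw [← lintegral_indicator measurableSet_Ioo]
    refine lintegral_congr fun z ↦ ?_
    simp only [hS, Set.indicator, Set.mem_ofPred_eq, Set.mem_Ioo, abs_lt, Function.uncurry]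
  calc _ = ∫⁻ z : ℝ, ∫⁻ r : ℝ, S.indicator (Function.uncurry K) (r, z) := by
        refine lintegral_congr fun z ↦ ?_
        rw [← lintegral_indicator measurableSet_Ioi]
        rfl
    _ = ∫⁻ r : ℝ, ∫⁻ z : ℝ, S.indicator (Function.uncurry K) (r, z) :=
        lintegral_lintegral_swap ((hK.indicator hSm).comp measurable_swap).aemeasurable
    _ = ∫⁻ r : ℝ, ∫⁻ z in Set.Ioo (-r) r, K r z := lintegral_congr hslice
    _ = _ := by
        refine (setLIntegral_eq_of_support_subset (Function.support_subset_iff'.2 ?_)).symm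
        intro r hr
        rw [Set.mem_Ioi, not_lt] at hr
        rw [Set.Ioo_eq_empty (by linarith), setLIntegral_empty]

/-- The hat-box theorem of Archimedes: on the sphere of radius `r` the coordinate `⟪e, q⟫` is
uniformly distributed on `(-r, r)`. -/
theorem lintegral_zonal {F : ℝ → ℝ → ℝ≥0∞} (hF : Measurable (Function.uncurry F))
    {e : EuclideanSpace ℝ (Fin 3)} (he : ‖e‖ = 1) :
    ∫⁻ q : EuclideanSpace ℝ (Fin 3), F ‖q‖ (inner ℝ e q) =
      ∫⁻ r in Set.Ioi (0 : ℝ),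
        ENNReal.ofReal (2 * Real.pi * r) * ∫⁻ z in Set.Ioo (-r) r, F r z := by
  set e₀ : EuclideanSpace ℝ (Fin 3) := EuclideanSpace.single 0 1 with he₀
  set A := (Submodule.span ℝ {e - e₀})ᗮ.reflection
  have hA : A e = e₀ := Submodule.reflection_sub (by simp [he₀, he])
  have hnorm (q : EuclideanSpace ℝ (Fin 3)) : ‖q‖ = √(q 0 ^ 2 + (q 1 ^ 2 + q 2 ^ 2)) := by
    simp [EuclideanSpace.norm_eq, Fin.sum_univ_three, add_assoc]
  have hFm (r : ℝ) : Measurable (F r) := hF.comp measurable_prodMk_left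
  calc _ = ∫⁻ q, F ‖A q‖ (inner ℝ e₀ (A q)) := by
        simp_rw [← hA, A.inner_map_map, A.norm_map]
    _ = ∫⁻ q, F ‖q‖ (inner ℝ e₀ q) := A.measurePreserving.lintegral_comp
        (hF.comp (by fun_prop : Measurable fun q : EuclideanSpace ℝ (Fin 3) ↦
          (‖q‖, inner ℝ e₀ q)))
    _ = ∫⁻ q : EuclideanSpace ℝ (Fin 3), F √(q 0 ^ 2 + (q 1 ^ 2 + q 2 ^ 2)) (q 0) := by
        simp [he₀, hnorm, EuclideanSpace.inner_single_left]
    _ = ENNReal.ofReal Real.pi * ∫⁻ z : ℝ, ∫⁻ t in Set.Ioi (0 : ℝ), F √(z ^ 2 + t) z :=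
        lintegral_euclideanSpace_fin_three (H := fun z t ↦ F √(z ^ 2 + t) z)
          (hF.comp (by fun_prop : Measurable fun p : ℝ × ℝ ↦ (√(p.1 ^ 2 + p.2), p.1)))
    _ = ENNReal.ofReal Real.pi *
          ∫⁻ z : ℝ, ∫⁻ r in Set.Ioi |z|, ENNReal.ofReal (2 * r) * F r z := by
        congr 1
        refine lintegral_congr fun z ↦ ?_
        rw [lintegral_Ioi_zero_eq_lintegral_sq_sub_sq _ (abs_nonneg z)]
        refine setLIntegral_congr_fun measurableSet_Ioi fun r (hr : |z| < r) ↦ ?_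
        simp only [sq_abs, add_sub_cancel, Real.sqrt_sq ((abs_nonneg z).trans hr.le)]
    _ = ENNReal.ofReal Real.pi * ∫⁻ r in Set.Ioi (0 : ℝ), ∫⁻ z in Set.Ioo (-r) r,
          ENNReal.ofReal (2 * r) * F r z := by
        rw [lintegral_lintegral_Ioi_abs_swap (K := fun r z ↦ ENNReal.ofReal (2 * r) * F r z)
          ((by fun_prop : Measurable fun p : ℝ × ℝ ↦ ENNReal.ofReal (2 * p.1)).mul hF)]
    _ = _ := by
        rw [← lintegral_const_mul' _ _ ENNReal.ofReal_ne_top]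
        refine lintegral_congr fun r ↦ ?_
        rw [lintegral_const_mul _ (hFm r), ← mul_assoc, ← ENNReal.ofReal_mul Real.pi_pos.le]
        ring_nf

theorem lintegral_Ioo_inv_sq_add_sq_sub {r P : ℝ} (hr : 0 < r) (hP : 0 < P) (hrP : r ≠ P) :
    ∫⁻ z in Set.Ioo (-r) r, ENNReal.ofReal (r ^ 2 + P ^ 2 - 2 * P * z)⁻¹ =
      ENNReal.ofReal (P⁻¹ * Real.log ((r + P) / |r - P|)) := by
  have hrP' : 0 < |r - P| := abs_pos.2 (sub_ne_zero.2 hrP)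
  have hle : -r ≤ r := by linarith
  have hpos : ∀ z ∈ Set.Icc (-r) r, 0 < r ^ 2 + P ^ 2 - 2 * P * z := fun z hz ↦ by
    nlinarith [hz.2, sq_abs (r - P), pow_pos hrP' 2]
  have hint : IntervalIntegrable (fun z ↦ (r ^ 2 + P ^ 2 - 2 * P * z)⁻¹) volume (-r) r :=
    ContinuousOn.intervalIntegrable <| by
      rw [Set.uIcc_of_le hle]
      exact ContinuousOn.inv₀ (by fun_prop) fun z hz ↦ (hpos z hz).ne'
  have hderiv : ∀ z ∈ Set.uIcc (-r) r, HasDerivAt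
      (fun z ↦ -(2 * P)⁻¹ * Real.log (r ^ 2 + P ^ 2 - 2 * P * z))
      (r ^ 2 + P ^ 2 - 2 * P * z)⁻¹ z := fun z hz ↦ by
    rw [Set.uIcc_of_le hle] at hz
    convert! ((((hasDerivAt_id z).const_mul (2 * P)).const_sub (r ^ 2 + P ^ 2)).log
      (hpos z hz).ne').const_mul (-(2 * P)⁻¹) using 1
    simp only [id_eq, mul_one]
    field_simp
  rw [setLIntegral_congr Ioo_ae_eq_Ioc, ← ofReal_integral_eq_lintegral_ofReal hint.1
    ((ae_restrict_mem measurableSet_Ioc).mono fun z hz ↦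
      (inv_pos.2 (hpos z (Set.Ioc_subset_Icc_self hz))).le),
    ← intervalIntegral.integral_of_le hle,
    intervalIntegral.integral_eq_sub_of_hasDerivAt hderiv hint,
    show r ^ 2 + P ^ 2 - 2 * P * r = |r - P| ^ 2 by rw [sq_abs]; ring,
    show r ^ 2 + P ^ 2 - 2 * P * -r = (r + P) ^ 2 by ring, Real.log_pow, Real.log_pow,
    Real.log_div (by positivity) hrP'.ne', Nat.cast_ofNat]
  congr 1
  field_simp
  ring

theorem lintegral_inv_sq_dist_mul_comp_norm {f : ℝ → ℝ≥0∞} (hf : Measurable f)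
    {p : EuclideanSpace ℝ (Fin 3)} (hp : p ≠ 0) :
    ∫⁻ q : EuclideanSpace ℝ (Fin 3), ENNReal.ofReal (‖p - q‖ ^ 2)⁻¹ * f ‖q‖ =
      ENNReal.ofReal (2 * Real.pi) * ∫⁻ r in Set.Ioi (0 : ℝ),
        ENNReal.ofReal (r / ‖p‖ * Real.log ((r + ‖p‖) / |r - ‖p‖|)) * f r := by
  have hp₀ : 0 < ‖p‖ := norm_pos_iff.2 hp
  set F : ℝ → ℝ → ℝ≥0∞ := fun r z ↦
    ENNReal.ofReal (r ^ 2 + ‖p‖ ^ 2 - 2 * ‖p‖ * z)⁻¹ * f r with hF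
  have hFm : Measurable (Function.uncurry F) := by
    simp only [hF, Function.uncurry_def]
    fun_prop
  have hF_norm (q : EuclideanSpace ℝ (Fin 3)) :
      ENNReal.ofReal (‖p - q‖ ^ 2)⁻¹ * f ‖q‖ = F ‖q‖ (inner ℝ (‖p‖⁻¹ • p) q) := by
    rw [hF, real_inner_smul_left, norm_sub_sq_real]
    field_simp
    ring_nf
  have hunit : ‖‖p‖⁻¹ • p‖ = 1 := by
    rw [norm_smul, norm_inv, norm_norm, inv_mul_cancel₀ hp₀.ne']
  simp_rw [hF_norm]
  rw [lintegral_zonal hFm hunit,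
    ← lintegral_const_mul' _ _ ENNReal.ofReal_ne_top]
  refine lintegral_congr_ae ?_
  filter_upwards [ae_restrict_mem measurableSet_Ioi, ae_restrict_of_ae (Measure.ae_ne volume ‖p‖)]
    with r (hr : 0 < r) hrp
  rw [lintegral_mul_const _ (by fun_prop), lintegral_Ioo_inv_sq_add_sq_sub hr hp₀ hrp, ← mul_assoc,
    ← mul_assoc, ← ENNReal.ofReal_mul (by positivity), ← ENNReal.ofReal_mul (by positivity)]
  ring_nf

end RadialIntegrals

section LogKernel

theorem log_one_add_le_self {x : ℝ} (hx : -1 < x) : Real.log (1 + x) ≤ x := by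
  linarith [Real.log_le_sub_one_of_pos (x := 1 + x) (by linarith)]

theorem log_one_add_nonneg {x : ℝ} (hx : 0 ≤ x) : 0 ≤ Real.log (1 + x) :=
  Real.log_nonneg (by linarith)

theorem log_one_add_div_le_add {a d k : ℝ} (ha : 0 ≤ a) (hd : 0 < d) (hk : 0 < k) :
    Real.log (1 + a / d) ≤ Real.log (1 + a / k) + Real.log (1 + k / d) := by
  rw [← Real.log_mul (by positivity) (by positivity)]
  refine Real.log_le_log (by positivity) ?_
  have hexpand : (1 + a / k) * (1 + k / d) = 1 + a / d + (a / k + k / d) := by field_simp; ring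
  rw [hexpand]
  exact le_add_of_nonneg_right (by positivity)

theorem div_mul_log_add_div_abs_sub_le_of_lt {r P : ℝ} (hr : 0 < r) (h : r < P) :
    r / P * Real.log ((r + P) / |r - P|) ≤ Real.log (1 + 2 * r / |r - P|) := by
  have hd : 0 < |r - P| := abs_pos.2 (sub_ne_zero.2 h.ne)
  have hquot : (r + P) / |r - P| = 1 + 2 * r / |r - P| := by
    have habs : |r - P| = P - r := by rw [abs_of_neg (by linarith), neg_sub]
    rw [eq_comm, one_add_div hd.ne', habs]
    ring_nf
  rw [hquot]
  exact mul_le_of_le_one_left (log_one_add_nonneg (by positivity))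
    ((div_le_one (hr.trans h)).2 h.le)

theorem div_mul_log_add_div_abs_sub_le_of_gt {r P : ℝ} (hP : 0 < P) (h : P < r) :
    r / P * Real.log ((r + P) / |r - P|) ≤ 2 + Real.log (1 + 2 * r / |r - P|) := by
  have hd : 0 < r - P := sub_pos.2 h
  have hquot : (r + P) / (r - P) = 1 + 2 * P / (r - P) := by field_simp; ring
  have hlog_le : (r - P) / P * Real.log (1 + 2 * P / (r - P)) ≤ 2 := by
    calc _ ≤ (r - P) / P * (2 * P / (r - P)) := by
          gcongr
          exact log_one_add_le_self (neg_one_lt_zero.trans (by positivity))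
      _ = 2 := by field_simp
  rw [abs_of_pos hd, hquot]
  calc r / P * Real.log (1 + 2 * P / (r - P))
      = (r - P) / P * Real.log (1 + 2 * P / (r - P)) + Real.log (1 + 2 * P / (r - P)) := by
        field_simp; ring
    _ ≤ 2 + Real.log (1 + 2 * r / (r - P)) := by gcongr

theorem div_mul_log_add_div_abs_sub_le {r P : ℝ} (hr : 0 < r) (hP : 0 < P) (h : r ≠ P) :
    r / P * Real.log ((r + P) / |r - P|) ≤ 2 + Real.log (1 + 2 * r / |r - P|) := by
  rcases h.lt_or_gt with h | h
  · exact (div_mul_log_add_div_abs_sub_le_of_lt hr h).trans (by linarith)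
  · exact div_mul_log_add_div_abs_sub_le_of_gt hP h

/-- Majorant of the logarithmic singularity at `r = P`, as a function of `w = |r - P| / k`. -/
noncomputable def logProfile (w : ℝ) : ℝ := 4 + Real.log (1 + 1 / w)

theorem measurable_logProfile : Measurable logProfile := by
  unfold logProfile; fun_prop

theorem four_le_logProfile {w : ℝ} (hw : 0 < w) : 4 ≤ logProfile w :=
  le_add_of_nonneg_right (log_one_add_nonneg (by positivity))

theorem antitoneOn_logProfile : AntitoneOn logProfile (Set.Ioi 0) := by
  intro a (ha : 0 < a) b (hb : 0 < b) hab
  unfold logProfile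
  gcongr

theorem logProfile_le_of_le_one {w : ℝ} (hw : 0 < w) (hw₁ : w ≤ 1) :
    logProfile w ≤ 5 - Real.log w := by
  have hquot : 1 + 1 / w = (1 + w) / w := by field_simp; ring
  rw [logProfile, hquot, Real.log_div (by positivity) hw.ne']
  linarith [log_one_add_le_self (x := w) (by linarith)]

theorem logProfile_le_of_one_le {w : ℝ} (hw : 1 ≤ w) : logProfile w ≤ 5 := by
  have hinv : 1 / w ≤ 1 := (div_le_one (by linarith)).2 hw
  have hlog := log_one_add_le_self (x := 1 / w) (neg_one_lt_zero.trans (by positivity))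
  rw [logProfile]
  linarith

theorem log_kernel_le_logProfile_mul {k P r : ℝ} (hk : 0 < k) (hP : 0 < P) (hr : 0 < r)
    (h : r ≠ P) :
    r / P * Real.log ((r + P) / |r - P|) ≤
      logProfile (|r - P| / k) * (1 + Real.log (1 + |r - k| / k)) := by
  have hd : 0 < |r - P| := abs_pos.2 (sub_ne_zero.2 h)
  have hratio : 1 + 2 * r / k ≤ 3 * (1 + |r - k| / k) := by
    have : r / k ≤ 1 + |r - k| / k := by
      rw [one_add_div hk.ne']
      gcongr
      linarith [le_abs_self (r - k)]
    have hdist : 0 ≤ |r - k| / k := by positivity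
    rw [mul_div_assoc]
    linarith
  have hlog : Real.log (1 + 2 * r / k) ≤ 2 + Real.log (1 + |r - k| / k) := by
    have hlog_three : Real.log 3 ≤ 2 := by
      linarith [Real.log_le_sub_one_of_pos (x := 3) (by norm_num)]
    calc Real.log (1 + 2 * r / k) ≤ Real.log (3 * (1 + |r - k| / k)) :=
          Real.log_le_log (by positivity) hratio
      _ = Real.log 3 + Real.log (1 + |r - k| / k) := Real.log_mul (by norm_num) (by positivity)
      _ ≤ _ := by gcongr
  have hprofile : logProfile (|r - P| / k) = 4 + Real.log (1 + k / |r - P|) := by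
    rw [logProfile, one_div_div]
  nlinarith [div_mul_log_add_div_abs_sub_le hr hP h,
    log_one_add_div_le_add (a := 2 * r) (by positivity) hd hk,
    four_le_logProfile (div_pos hd hk), log_one_add_nonneg (x := |r - k| / k) (by positivity)]

/-- Majorant of `(1 + log (1 + w)) / max (2 * τ) (w * max 1 w)`, the inverse symbol at temperature
`τ` together with a logarithmic correction, as a function of the relative distance `w = |r - k| / k`
to the Fermi momentum `k`. -/
noncomputable def symbolProfile (τ w : ℝ) : ℝ :=
  if w ≤ 1 then 1 / max τ w + 2 else 3 * w ^ (-(3 / 2) : ℝ)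

theorem measurable_symbolProfile (τ : ℝ) : Measurable (symbolProfile τ) :=
  Measurable.ite measurableSet_Iic (by fun_prop) (by fun_prop)

theorem symbolProfile_nonneg (τ : ℝ) {w : ℝ} (hw : 0 < w) : 0 ≤ symbolProfile τ w := by
  unfold symbolProfile
  split_ifs <;> positivity

theorem antitoneOn_symbolProfile {τ : ℝ} (hτ : τ ≤ 1) :
    AntitoneOn (symbolProfile τ) (Set.Ioi 0) := by
  intro a (ha : 0 < a) b _ hab
  unfold symbolProfile
  split_ifs with hb₁ ha₁ ha₁
  · gcongr
  · exact absurd (hab.trans hb₁) ha₁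
  · have hmax : 1 ≤ 1 / max τ a := (one_le_div (by positivity)).2 (max_le hτ ha₁)
    have hpow : b ^ (-(3 / 2) : ℝ) ≤ 1 :=
      Real.rpow_le_one_of_one_le_of_nonpos (not_le.1 hb₁).le (by norm_num)
    linarith
  · gcongr 3 * ?_
    exact Real.rpow_le_rpow_of_nonpos ha hab (by norm_num)

theorem one_add_log_le_three_mul_sqrt {w : ℝ} (hw : 1 ≤ w) :
    1 + Real.log (1 + w) ≤ 3 * √w := by
  have hsqrt : 1 ≤ √w := Real.one_le_sqrt.2 hw
  have hlog : Real.log (1 + w) ≤ 2 * Real.log (1 + √w) := by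
    rw [← Nat.cast_ofNat (n := 2), ← Real.log_pow]
    refine Real.log_le_log (by positivity) ?_
    nlinarith [Real.sq_sqrt (zero_le_one.trans hw)]
  linarith [log_one_add_le_self (x := √w) (by linarith)]

theorem one_add_log_div_le_symbolProfile {τ w : ℝ} (hτ : 0 < τ) (hw : 0 < w) :
    (1 + Real.log (1 + w)) / max (2 * τ) (w * max 1 w) ≤ symbolProfile τ w := by
  unfold symbolProfile
  split_ifs with hw₁
  · rw [max_eq_left hw₁, mul_one]
    have hmax : max τ w ≤ max (2 * τ) w := max_le_max (by linarith) le_rfl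
    have hdiv : w / max (2 * τ) w ≤ 1 := (div_le_one (by positivity)).2 (le_max_right _ _)
    calc _ ≤ (1 + w) / max (2 * τ) w := by
          gcongr
          exact log_one_add_le_self (by linarith)
      _ = 1 / max (2 * τ) w + w / max (2 * τ) w := add_div _ _ _
      _ ≤ 1 / max τ w + 2 := by
          gcongr
          linarith
  · have hw₁ : 1 ≤ w := (not_le.1 hw₁).le
    rw [max_eq_right hw₁]
    calc _ ≤ 3 * √w / (w * w) :=
          div_le_div₀ (by positivity) (one_add_log_le_three_mul_sqrt hw₁) (by positivity)
            (le_max_right _ _)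
      _ = 3 * w ^ (-(3 / 2) : ℝ) := by
          rw [Real.sqrt_eq_rpow, mul_div_assoc, ← sq, ← Real.rpow_natCast, ← Real.rpow_sub hw]
          norm_num

theorem inv_max_abs_sq_sub_sq_le {k τ r : ℝ} (hk : 0 < k) (hτ : 0 < τ) (hr : 0 ≤ r) :
    (max (2 * τ * k ^ 2) |r ^ 2 - k ^ 2|)⁻¹ ≤
      (k ^ 2)⁻¹ * (max (2 * τ) (|r - k| / k * max 1 (|r - k| / k)))⁻¹ := by
  have hsum : k * max 1 (|r - k| / k) ≤ r + k := by
    rw [mul_max_of_nonneg _ _ hk.le, mul_one, mul_div_cancel₀ _ hk.ne']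
    exact max_le (by linarith) (abs_le.2 ⟨by linarith, by linarith⟩)
  rw [← mul_inv]
  refine inv_anti₀ (by positivity) ?_
  rw [mul_max_of_nonneg _ _ (by positivity), mul_comm (k ^ 2) (2 * τ)]
  refine max_le_max le_rfl ?_
  calc k ^ 2 * (|r - k| / k * max 1 (|r - k| / k))
      = |r - k| * (k * max 1 (|r - k| / k)) := by field_simp
    _ ≤ |r - k| * (r + k) := by gcongr
    _ = |r ^ 2 - k ^ 2| := by
        rw [← abs_of_pos (add_pos_of_nonneg_of_pos hr hk), ← abs_mul]
        ring_nf

theorem mul_le_add_of_antitoneOn {α : Type*} [LinearOrder α] {s : Set α} {f g : α → ℝ}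
    (hf : AntitoneOn f s) (hg : AntitoneOn g s) (hf₀ : ∀ w ∈ s, 0 ≤ f w)
    (hg₀ : ∀ w ∈ s, 0 ≤ g w) {v w : α} (hv : v ∈ s) (hw : w ∈ s) :
    f v * g w ≤ f w * g w + f v * g v := by
  rcases le_total w v with h | h
  · exact (mul_le_mul_of_nonneg_right (hf hw hv h) (hg₀ w hw)).trans
      (le_add_of_nonneg_right (mul_nonneg (hf₀ v hv) (hg₀ v hv)))
  · exact (mul_le_mul_of_nonneg_left (hg hv hw h) (hf₀ v hv)).trans
      (le_add_of_nonneg_left (mul_nonneg (hf₀ w hw) (hg₀ w hw)))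

/-- Product of the two majorants of the integrand of the logarithmic kernel against the inverse
symbol, regarded as a single function of the relative distance `w` to either singularity. -/
noncomputable def kernelProfile (τ w : ℝ) : ℝ := logProfile w * symbolProfile τ w

theorem measurable_kernelProfile (τ : ℝ) : Measurable (kernelProfile τ) :=
  measurable_logProfile.mul (measurable_symbolProfile τ)

theorem kernelProfile_nonneg (τ : ℝ) {w : ℝ} (hw : 0 < w) : 0 ≤ kernelProfile τ w :=
  mul_nonneg (by linarith [four_le_logProfile hw]) (symbolProfile_nonneg τ hw)

theorem log_kernel_mul_inv_symbol_le {k τ P r : ℝ} (hk : 0 < k) (hτ : 0 < τ) (hτ₁ : τ ≤ 1)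
    (hP : 0 < P) (hr : 0 < r) (hrk : r ≠ k) (hrP : r ≠ P) :
    r / P * Real.log ((r + P) / |r - P|) * (max (2 * τ * k ^ 2) |r ^ 2 - k ^ 2|)⁻¹ ≤
      (k ^ 2)⁻¹ * (kernelProfile τ (|r - k| / k) + kernelProfile τ (|r - P| / k)) := by
  have hlog := log_kernel_le_logProfile_mul hk hP hr hrP
  have hsymbol := inv_max_abs_sq_sub_sq_le hk hτ hr.le
  set w := |r - k| / k
  set v := |r - P| / k
  have hw : 0 < w := div_pos (abs_pos.2 (sub_ne_zero.2 hrk)) hk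
  have hv : 0 < v := div_pos (abs_pos.2 (sub_ne_zero.2 hrP)) hk
  have hlog_nonneg := log_one_add_nonneg hw.le
  have hlogProfile : ∀ u : ℝ, 0 < u → 0 ≤ logProfile u := fun u hu ↦ by
    linarith [four_le_logProfile hu]
  calc _ ≤ logProfile v * (1 + Real.log (1 + w)) *
        ((k ^ 2)⁻¹ * (max (2 * τ) (w * max 1 w))⁻¹) :=
        mul_le_mul hlog hsymbol (by positivity)
          (mul_nonneg (hlogProfile v hv) (by positivity))
    _ = (k ^ 2)⁻¹ * (logProfile v * ((1 + Real.log (1 + w)) / max (2 * τ) (w * max 1 w))) := by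
        rw [div_eq_mul_inv]; ring
    _ ≤ (k ^ 2)⁻¹ * (logProfile v * symbolProfile τ w) := by
        gcongr
        · exact hlogProfile v hv
        · exact one_add_log_div_le_symbolProfile hτ hw
    _ ≤ _ := by
        gcongr
        exact mul_le_add_of_antitoneOn antitoneOn_logProfile (antitoneOn_symbolProfile hτ₁)
          hlogProfile (fun _ ↦ symbolProfile_nonneg τ) hv hw

theorem lintegral_comp_abs (g : ℝ → ℝ≥0∞) : ∫⁻ x, g |x| = 2 * ∫⁻ x in Set.Ioi 0, g x := by
  have hpos : ∫⁻ x in Set.Ioi 0, g |x| = ∫⁻ x in Set.Ioi 0, g x :=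
    setLIntegral_congr_fun measurableSet_Ioi fun x hx ↦ by rw [abs_of_pos hx]
  have hneg : ∫⁻ x in Set.Iic 0, g |x| = ∫⁻ x in Set.Ioi 0, g x := by
    rw [← setLIntegral_congr Iio_ae_eq_Iic, ← hpos,
      ← (Measure.measurePreserving_neg volume).setLIntegral_comp_preimage_emb
        (MeasurableEquiv.neg ℝ).measurableEmbedding (fun x ↦ g |x|) (Set.Ioi 0)]
    simp only [abs_neg, Set.neg_preimage, Set.neg_Ioi, neg_zero]
  rw [← lintegral_add_compl _ measurableSet_Ioi, Set.compl_Ioi, hpos, hneg, two_mul]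

theorem lintegral_comp_div (g : ℝ → ℝ≥0∞) {k : ℝ} (hk : 0 < k) :
    ∫⁻ x, g (x / k) = ENNReal.ofReal k * ∫⁻ x, g x := by
  have hmap : (volume : Measure ℝ).map (· * k⁻¹) = ENNReal.ofReal k • volume := by
    rw [Real.map_volume_mul_right (inv_ne_zero hk.ne'), inv_inv, abs_of_pos hk]
  rw [← smul_eq_mul, ← lintegral_smul_measure, ← hmap,
    (measurableEmbedding_mulRight₀ (inv_ne_zero hk.ne')).lintegral_map]
  simp only [div_eq_mul_inv]

theorem lintegral_comp_abs_sub_div (g : ℝ → ℝ≥0∞) (a : ℝ) {k : ℝ} (hk : 0 < k) :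
    ∫⁻ r, g (|r - a| / k) = 2 * ENNReal.ofReal k * ∫⁻ w in Set.Ioi 0, g w := by
  rw [lintegral_sub_right_eq_self (fun x ↦ g (|x| / k)) a]
  calc ∫⁻ x, g (|x| / k) = ∫⁻ x, g |x / k| := by simp only [abs_div, abs_of_pos hk]
    _ = _ := by rw [lintegral_comp_div (fun x ↦ g |x|) hk, lintegral_comp_abs]; ring

theorem lintegral_kernelProfile_Ioc_zero_le {τ : ℝ} (hτ : 0 < τ) (hτ₁ : τ ≤ 1) :
    ∫⁻ w in Set.Ioc 0 τ, ENNReal.ofReal (kernelProfile τ w) ≤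
      ENNReal.ofReal (3 * (6 + Real.log τ⁻¹)) := by
  have hint : IntervalIntegrable (fun w ↦ (5 - Real.log w) * (1 / τ + 2)) volume 0 τ :=
    (intervalIntegrable_const.sub intervalIntegral.intervalIntegrable_log').mul_const _
  have hL : 0 ≤ Real.log τ⁻¹ := Real.log_nonneg ((one_le_inv₀ hτ).2 hτ₁)
  calc _ ≤ ∫⁻ w in Set.Ioc 0 τ, ENNReal.ofReal ((5 - Real.log w) * (1 / τ + 2)) := by
        refine setLIntegral_mono' measurableSet_Ioc fun w hw ↦ ENNReal.ofReal_le_ofReal ?_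
        have hw₁ := hw.2.trans hτ₁
        rw [kernelProfile, symbolProfile, if_pos hw₁, max_eq_left hw.2]
        gcongr
        exact logProfile_le_of_le_one hw.1 hw₁
    _ = ENNReal.ofReal (∫ w in (0)..τ, (5 - Real.log w) * (1 / τ + 2)) := by
        rw [intervalIntegral.integral_of_le hτ.le, ofReal_integral_eq_lintegral_ofReal hint.1]
        filter_upwards [ae_restrict_mem measurableSet_Ioc] with w hw
        have hlog := Real.log_nonpos hw.1.le (hw.2.trans hτ₁)
        exact mul_nonneg (by linarith) (by positivity)
    _ = ENNReal.ofReal ((6 + Real.log τ⁻¹) * (1 + 2 * τ)) := by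
        rw [intervalIntegral.integral_mul_const, intervalIntegral.integral_sub
          intervalIntegrable_const intervalIntegral.intervalIntegrable_log', integral_log,
          intervalIntegral.integral_const, Real.log_inv, smul_eq_mul]
        congr 1
        field_simp
        ring
    _ ≤ _ := ENNReal.ofReal_le_ofReal (by nlinarith)

theorem integral_five_sub_log_mul_one_div_add_two {a b : ℝ} (ha : 0 < a) (hab : a ≤ b) :
    ∫ w in a..b, (5 - Real.log w) * (1 / w + 2) =
      (5 * Real.log b - Real.log b ^ 2 / 2 + 12 * b - 2 * (b * Real.log b)) -
        (5 * Real.log a - Real.log a ^ 2 / 2 + 12 * a - 2 * (a * Real.log a)) := by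
  have hne : ∀ w ∈ Set.uIcc a b, w ≠ 0 := fun w hw ↦ by
    rw [Set.uIcc_of_le hab] at hw
    exact (ha.trans_le hw.1).ne'
  have hint : IntervalIntegrable (fun w ↦ (5 - Real.log w) * (1 / w + 2)) volume a b :=
    ContinuousOn.intervalIntegrable <| (continuousOn_const.sub (continuousOn_id.log hne)).mul
      ((continuousOn_const.div continuousOn_id hne).add continuousOn_const)
  refine intervalIntegral.integral_eq_sub_of_hasDerivAt (f := fun w ↦
    5 * Real.log w - Real.log w ^ 2 / 2 + 12 * w - 2 * (w * Real.log w)) (fun w hw ↦ ?_) hint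
  have hlog := Real.hasDerivAt_log (hne w hw)
  refine ((((hlog.const_mul 5).sub ((hlog.pow 2).div_const 2)).add
    ((hasDerivAt_id w).const_mul 12)).sub
    (((hasDerivAt_id w).mul hlog).const_mul 2)).congr_deriv ?_
  have := hne w hw
  simp only [id]
  field_simp
  ring

theorem lintegral_kernelProfile_Ioc_one_le {τ : ℝ} (hτ : 0 < τ) (hτ₁ : τ ≤ 1) :
    ∫⁻ w in Set.Ioc τ 1, ENNReal.ofReal (kernelProfile τ w) ≤
      ENNReal.ofReal (Real.log τ⁻¹ ^ 2 / 2 + 5 * Real.log τ⁻¹ + 12) := by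
  have hnonneg : ∀ w ∈ Set.Ioc τ 1, 0 ≤ (5 - Real.log w) * (1 / w + 2) := fun w hw ↦ by
    have hw₀ := hτ.trans hw.1
    have hlog := Real.log_nonpos hw₀.le hw.2
    exact mul_nonneg (by linarith) (by positivity)
  have hint : IntegrableOn (fun w ↦ (5 - Real.log w) * (1 / w + 2)) (Set.Ioc τ 1) := by
    refine ContinuousOn.integrableOn_Icc (fun w hw ↦ ?_) |>.mono_set Set.Ioc_subset_Icc_self
    have hw₀ : w ≠ 0 := (hτ.trans_le hw.1).ne'
    fun_prop (disch := assumption)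
  calc _ ≤ ∫⁻ w in Set.Ioc τ 1, ENNReal.ofReal ((5 - Real.log w) * (1 / w + 2)) := by
        refine setLIntegral_mono' measurableSet_Ioc fun w hw ↦ ENNReal.ofReal_le_ofReal ?_
        have hw₀ := hτ.trans hw.1
        rw [kernelProfile, symbolProfile, if_pos hw.2, max_eq_right hw.1.le]
        gcongr
        exact logProfile_le_of_le_one hw₀ hw.2
    _ = ENNReal.ofReal (∫ w in τ..1, (5 - Real.log w) * (1 / w + 2)) := by
        rw [intervalIntegral.integral_of_le hτ₁, ofReal_integral_eq_lintegral_ofReal hint]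
        exact (ae_restrict_mem measurableSet_Ioc).mono hnonneg
    _ ≤ _ := by
        refine ENNReal.ofReal_le_ofReal ?_
        have hlog : 0 ≤ -Real.log τ := neg_nonneg.2 (Real.log_nonpos hτ.le hτ₁)
        rw [integral_five_sub_log_mul_one_div_add_two hτ hτ₁, Real.log_one, Real.log_inv]
        nlinarith [mul_nonneg hτ.le hlog]

theorem lintegral_kernelProfile_Ioi_one_le (τ : ℝ) :
    ∫⁻ w in Set.Ioi 1, ENNReal.ofReal (kernelProfile τ w) ≤ ENNReal.ofReal 30 := by
  have hint := integrableOn_Ioi_rpow_of_lt (a := -(3 / 2)) (by norm_num) one_pos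
  calc _ ≤ ∫⁻ w in Set.Ioi (1 : ℝ), ENNReal.ofReal (5 * (3 * w ^ (-(3 / 2) : ℝ))) := by
        refine setLIntegral_mono' measurableSet_Ioi fun w (hw : 1 < w) ↦
          ENNReal.ofReal_le_ofReal ?_
        rw [kernelProfile, symbolProfile, if_neg (not_le.2 hw)]
        gcongr
        exact logProfile_le_of_one_le hw.le
    _ = ENNReal.ofReal (∫ w in Set.Ioi (1 : ℝ), 5 * (3 * w ^ (-(3 / 2) : ℝ))) := by
        rw [ofReal_integral_eq_lintegral_ofReal ((hint.const_mul 3).const_mul 5)]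
        filter_upwards [ae_restrict_mem measurableSet_Ioi] with w hw
        have : 0 < w := one_pos.trans hw
        positivity
    _ = ENNReal.ofReal 30 := by
        rw [integral_const_mul, integral_const_mul,
          integral_Ioi_rpow_of_lt (by norm_num) one_pos]
        norm_num

theorem lintegral_kernelProfile_le {τ : ℝ} (hτ : 0 < τ) (hτ₁ : τ ≤ 1) :
    ∫⁻ w in Set.Ioi 0, ENNReal.ofReal (kernelProfile τ w) ≤
      ENNReal.ofReal ((Real.log τ⁻¹ + 11) ^ 2 / 2) := by
  have hL : 0 ≤ Real.log τ⁻¹ := Real.log_nonneg ((one_le_inv₀ hτ).2 hτ₁)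
  calc _ ≤ (∫⁻ w in Set.Ioc 0 τ, ENNReal.ofReal (kernelProfile τ w)) +
        ((∫⁻ w in Set.Ioc τ 1, ENNReal.ofReal (kernelProfile τ w)) +
          ∫⁻ w in Set.Ioi 1, ENNReal.ofReal (kernelProfile τ w)) := by
        rw [← Set.Ioc_union_Ioi_eq_Ioi hτ.le, ← Set.Ioc_union_Ioi_eq_Ioi hτ₁]
        exact (lintegral_union_le _ _ _).trans (by gcongr; exact lintegral_union_le _ _ _)
    _ ≤ ENNReal.ofReal (3 * (6 + Real.log τ⁻¹)) +
        (ENNReal.ofReal (Real.log τ⁻¹ ^ 2 / 2 + 5 * Real.log τ⁻¹ + 12) + ENNReal.ofReal 30) := by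
        gcongr
        exacts [lintegral_kernelProfile_Ioc_zero_le hτ hτ₁,
          lintegral_kernelProfile_Ioc_one_le hτ hτ₁, lintegral_kernelProfile_Ioi_one_le τ]
    _ ≤ _ := by
        rw [← ENNReal.ofReal_add (by positivity) (by norm_num),
          ← ENNReal.ofReal_add (by positivity) (by positivity)]
        exact ENNReal.ofReal_le_ofReal (by nlinarith)

theorem lintegral_log_kernel_le {k τ P : ℝ} (hk : 0 < k) (hτ : 0 < τ) (hτ₁ : τ ≤ 1)
    (hP : 0 < P) :
    ∫⁻ r in Set.Ioi 0, ENNReal.ofReal (r / P * Real.log ((r + P) / |r - P|)) *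
      ENNReal.ofReal (max (2 * τ * k ^ 2) |r ^ 2 - k ^ 2|)⁻¹ ≤
      ENNReal.ofReal (2 * (Real.log τ⁻¹ + 11) ^ 2 / k) := by
  set Φ : ℝ → ℝ≥0∞ := fun w ↦ ENNReal.ofReal (kernelProfile τ w)
  have hΦ : Measurable Φ := (measurable_kernelProfile τ).ennreal_ofReal
  calc _ ≤ ∫⁻ r in Set.Ioi 0, ENNReal.ofReal (k ^ 2)⁻¹ *
        (Φ (|r - k| / k) + Φ (|r - P| / k)) := by
        refine lintegral_mono_ae ?_
        filter_upwards [ae_restrict_of_ae (Measure.ae_ne volume k),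
          ae_restrict_of_ae (Measure.ae_ne volume P), ae_restrict_mem measurableSet_Ioi]
          with r hrk hrP hr
        have hw : 0 < |r - k| / k := div_pos (abs_pos.2 (sub_ne_zero.2 hrk)) hk
        have hv : 0 < |r - P| / k := div_pos (abs_pos.2 (sub_ne_zero.2 hrP)) hk
        rw [← ENNReal.ofReal_mul' (by positivity),
          ← ENNReal.ofReal_add (kernelProfile_nonneg τ hw) (kernelProfile_nonneg τ hv),
          ← ENNReal.ofReal_mul (by positivity)]
        exact ENNReal.ofReal_le_ofReal (log_kernel_mul_inv_symbol_le hk hτ hτ₁ hP hr hrk hrP)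
    _ ≤ ∫⁻ r, ENNReal.ofReal (k ^ 2)⁻¹ * (Φ (|r - k| / k) + Φ (|r - P| / k)) :=
        setLIntegral_le_lintegral _ _
    _ = ENNReal.ofReal (4 / k) * ∫⁻ w in Set.Ioi 0, Φ w := by
        have hconst : 4 / k = (k ^ 2)⁻¹ * (2 * (2 * k)) := by field_simp; norm_num
        rw [lintegral_const_mul' _ _ ENNReal.ofReal_ne_top, lintegral_add_left (by fun_prop),
          lintegral_comp_abs_sub_div Φ k hk, lintegral_comp_abs_sub_div Φ P hk, ← two_mul, hconst,
          ENNReal.ofReal_mul (by positivity), ENNReal.ofReal_mul zero_le_two,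
          ENNReal.ofReal_mul zero_le_two, ENNReal.ofReal_ofNat]
        ring
    _ ≤ ENNReal.ofReal (4 / k) * ENNReal.ofReal ((Real.log τ⁻¹ + 11) ^ 2 / 2) := by
        gcongr
        exact lintegral_kernelProfile_le hτ hτ₁
    _ = _ := by
        rw [← ENNReal.ofReal_mul (by positivity)]
        congr 1
        ring

end LogKernel

section CriticalTemperature

theorem sinh_le_mul_cosh {x : ℝ} (hx : 0 ≤ x) : Real.sinh x ≤ x * Real.cosh x := by
  have hderiv (y : ℝ) :
      HasDerivAt (fun y ↦ y * Real.cosh y - Real.sinh y) (y * Real.sinh y) y := by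
    refine (((hasDerivAt_id y).mul (Real.hasDerivAt_cosh y)).sub
      (Real.hasDerivAt_sinh y)).congr_deriv ?_
    rw [id, one_mul, add_sub_cancel_left]
  have hmono : MonotoneOn (fun y ↦ y * Real.cosh y - Real.sinh y) (Set.Ici 0) := by
    refine monotoneOn_of_hasDerivWithinAt_nonneg (convex_Ici 0)
      (fun y _ ↦ (hderiv y).continuousAt.continuousWithinAt)
      (fun y _ ↦ (hderiv y).hasDerivWithinAt) fun y hy ↦ ?_
    have hy₀ : 0 ≤ y := interior_subset hy
    exact mul_nonneg hy₀ (Real.sinh_nonneg_iff.2 hy₀)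
  have hx_le := hmono Set.self_mem_Ici hx hx
  simp only [zero_mul, Real.sinh_zero, sub_zero] at hx_le
  exact sub_nonneg.1 hx_le

theorem tanh_le_self {x : ℝ} (hx : 0 ≤ x) : Real.tanh x ≤ x := by
  rw [Real.tanh_eq_sinh_div_cosh, div_le_iff₀ (Real.cosh_pos x)]
  exact sinh_le_mul_cosh hx

/-- A lower bound for the symbol `K_{T,μ}` which is comparable to it and free of the hyperbolic
tangent. -/
noncomputable def symbolMinorant (T μ : ℝ) (p : R3) : ℝ := max (2 * T) |‖p‖ ^ 2 - μ|

theorem symbolMinorant_pos {T : ℝ} (hT : 0 < T) (μ : ℝ) (p : R3) : 0 < symbolMinorant T μ p :=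
  lt_max_of_lt_left (by positivity)

theorem measurable_symbolMinorant (T μ : ℝ) : Measurable (symbolMinorant T μ) := by
  unfold symbolMinorant; fun_prop

theorem symbolMinorant_le_bcsSymbol {T : ℝ} (hT : 0 < T) (μ : ℝ) (p : R3) :
    symbolMinorant T μ p ≤ bcsSymbol T μ p := by
  unfold symbolMinorant bcsSymbol
  split_ifs with h
  · rw [h, sub_self, abs_zero]
    exact max_le le_rfl (by positivity)
  · set x := |‖p‖ ^ 2 - μ|
    have hx : 0 < x := abs_pos.2 (sub_ne_zero.2 h)
    have htanh : 0 < Real.tanh (x / (2 * T)) := by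
      rw [Real.tanh_eq_sinh_div_cosh]
      exact div_pos (Real.sinh_pos_iff.2 (by positivity)) (Real.cosh_pos _)
    refine max_le ((le_div_iff₀ htanh).2 ?_) ((le_div_iff₀ htanh).2 ?_)
    · calc 2 * T * Real.tanh (x / (2 * T)) ≤ 2 * T * (x / (2 * T)) := by
            gcongr
            exact tanh_le_self (by positivity)
        _ = x := by field_simp
    · exact mul_le_of_le_one_right hx.le (Real.tanh_lt_one _).le

theorem symbolMinorant_le_symbolMinorant_of_le {T T' : ℝ} (h : T' ≤ T) (μ : ℝ) (p : R3) :
    symbolMinorant T' μ p ≤ symbolMinorant T μ p := by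
  unfold symbolMinorant
  gcongr

theorem symbolMinorant_self_le_symbolMinorant {T μ ν : ℝ} (hν : 0 ≤ ν) (hμν : μ ≤ ν)
    (hνT : ν ≤ T) (p : R3) : symbolMinorant ν ν p ≤ symbolMinorant T μ p := by
  have hp : 0 ≤ ‖p‖ ^ 2 := by positivity
  refine max_le (le_max_of_le_left (by linarith)) (abs_le'.2 ⟨?_, ?_⟩)
  · exact le_max_of_le_right ((by linarith : _ ≤ ‖p‖ ^ 2 - μ).trans (le_abs_self _))
  · exact le_max_of_le_left (by linarith)

theorem symbolMinorant_two_pi_smul (T : ℝ) {μ : ℝ} (hμ : 0 < μ) (η : R3) :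
    symbolMinorant T μ ((2 * Real.pi) • η) = 4 * Real.pi ^ 2 *
      max (2 * (T / μ) * (√μ / (2 * Real.pi)) ^ 2) |‖η‖ ^ 2 - (√μ / (2 * Real.pi)) ^ 2| := by
  have hfour : (0 : ℝ) < 4 * Real.pi ^ 2 := by positivity
  rw [mul_max_of_nonneg _ _ hfour.le, symbolMinorant, norm_smul,
    Real.norm_of_nonneg (by positivity), div_pow, Real.sq_sqrt hμ.le]
  congr 1
  · field_simp
    ring
  · conv_rhs => rw [← abs_of_pos hfour, ← abs_mul]
    congr 1
    field_simp
    ring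

theorem lintegral_rieszKernel_half_mul_inv_symbolMinorant_le {T μ : ℝ} (hT : 0 < T)
    (hTμ : T ≤ μ) {ξ : R3} (hξ : ξ ≠ 0) :
    ∫⁻ η, ENNReal.ofReal (rieszKernel (1 / 2) (ξ - η)) *
      (ENNReal.ofReal (symbolMinorant T μ ((2 * Real.pi) • η)))⁻¹ ≤
      ENNReal.ofReal (2 * (Real.log (μ / T) + 11) ^ 2 / (Real.pi * √μ)) := by
  have hμ : 0 < μ := hT.trans_le hTμ
  set k := √μ / (2 * Real.pi) with hk
  set f : ℝ → ℝ≥0∞ := fun r ↦ ENNReal.ofReal (max (2 * (T / μ) * k ^ 2) |r ^ 2 - k ^ 2|)⁻¹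
  calc _ = ∫⁻ η : R3, ENNReal.ofReal (4 * Real.pi ^ 3)⁻¹ *
        (ENNReal.ofReal (‖ξ - η‖ ^ 2)⁻¹ * f ‖η‖) := by
        refine lintegral_congr fun η ↦ ?_
        rw [← ENNReal.ofReal_inv_of_pos (symbolMinorant_pos hT _ _),
          symbolMinorant_two_pi_smul T hμ, rieszKernel_half,
          ← ENNReal.ofReal_mul (by positivity), ← ENNReal.ofReal_mul (by positivity),
          ← ENNReal.ofReal_mul (by positivity), ← hk]
        simp only [mul_inv]
        ring_nf
    _ = ENNReal.ofReal (4 * Real.pi ^ 3)⁻¹ * (ENNReal.ofReal (2 * Real.pi) *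
        ∫⁻ r in Set.Ioi 0,
          ENNReal.ofReal (r / ‖ξ‖ * Real.log ((r + ‖ξ‖) / |r - ‖ξ‖|)) * f r) := by
        rw [lintegral_const_mul' _ _ ENNReal.ofReal_ne_top,
          lintegral_inv_sq_dist_mul_comp_norm (by fun_prop) hξ]
    _ ≤ ENNReal.ofReal (4 * Real.pi ^ 3)⁻¹ * (ENNReal.ofReal (2 * Real.pi) *
        ENNReal.ofReal (2 * (Real.log (T / μ)⁻¹ + 11) ^ 2 / k)) := by
        gcongr
        exact lintegral_log_kernel_le (by positivity) (by positivity) ((div_le_one hμ).2 hTμ)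
          (norm_pos_iff.2 hξ)
    _ = _ := by
        rw [inv_div, ← ENNReal.ofReal_mul (by positivity), ← ENNReal.ofReal_mul (by positivity), hk]
        congr 1
        field_simp
        norm_num

theorem lintegral_inv_norm_mul_enorm_sq_le {T μ : ℝ} (hT : 0 < T) (hTμ : T ≤ μ)
    (ψ : Lp ℂ 2 (volume : Measure R3)) :
    ∫⁻ x, ENNReal.ofReal ‖x‖⁻¹ * ‖ψ x‖ₑ ^ 2 ≤
      ENNReal.ofReal (2 * (Real.log (μ / T) + 11) ^ 2 / (Real.pi * √μ)) *
        ∫⁻ ξ, ENNReal.ofReal (symbolMinorant T μ ((2 * Real.pi) • ξ)) *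
          ‖(𝓕 ψ : Lp ℂ 2 (volume : Measure R3)) ξ‖ₑ ^ 2 := by
  have hmeas : Measurable fun ξ : R3 ↦
      ENNReal.ofReal (symbolMinorant T μ ((2 * Real.pi) • ξ)) :=
    ((measurable_symbolMinorant T μ).comp (measurable_const_smul _)).ennreal_ofReal
  have hherbst := lintegral_rpow_norm_mul_enorm_sq_le_of_schur (s := 1 / 2) (by norm_num)
    (by rw [finrank_euclideanSpace_fin]; norm_num) hmeas
    (fun ξ ↦ (ENNReal.ofReal_pos.2 (symbolMinorant_pos hT _ _)).ne')
    (fun _ ↦ ENNReal.ofReal_ne_top)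
    ((Measure.ae_ne volume 0).mono fun _ ↦
      lintegral_rieszKernel_half_mul_inv_symbolMinorant_le hT hTμ) ψ
  simpa only [mul_one_div_cancel (two_ne_zero' ℝ), Real.rpow_neg_one] using hherbst

theorem weightedSupNorm_pos {V : R3 → ℝ} (hV : MemLp (fun x : R3 ↦ ‖x‖ * V x) ∞ volume)
    (hV₀ : ¬ V =ᵐ[volume] 0) : 0 < weightedSupNorm V := by
  refine lpNorm_nonneg.lt_of_ne fun h ↦ hV₀ ?_
  filter_upwards [(lpNorm_eq_zero hV ENNReal.top_ne_zero).1 h.symm, Measure.ae_ne volume 0]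
    with x hx hx₀
  exact (mul_eq_zero.1 hx).resolve_left (norm_ne_zero_iff.2 hx₀)

theorem aestronglyMeasurable_of_norm_mul {V : R3 → ℝ}
    (hV : AEStronglyMeasurable (fun x : R3 ↦ ‖x‖ * V x) volume) :
    AEStronglyMeasurable V volume := by
  have hinv : AEStronglyMeasurable (fun x : R3 ↦ ‖x‖⁻¹) volume :=
    measurable_norm.inv.aestronglyMeasurable
  refine (hinv.mul hV).congr ((Measure.ae_ne volume 0).mono fun x hx ↦ ?_)
  exact inv_mul_cancel_left₀ (norm_ne_zero_iff.2 hx) (V x)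

theorem lintegral_enorm_mul_le_weightedSupNorm_mul {V : R3 → ℝ}
    (hV : MemLp (fun x : R3 ↦ ‖x‖ * V x) ∞ volume) (u : R3 → ℝ≥0∞) :
    ∫⁻ x, ‖V x‖ₑ * u x ≤
      ENNReal.ofReal (weightedSupNorm V) * ∫⁻ x, ENNReal.ofReal ‖x‖⁻¹ * u x := by
  rw [← lintegral_const_mul' _ _ ENNReal.ofReal_ne_top]
  refine lintegral_mono_ae ?_
  filter_upwards [ae_le_lpNorm_exponent_top hV, Measure.ae_ne volume 0] with x hx hx₀
  rw [norm_mul, norm_norm] at hx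
  rw [← mul_assoc, weightedSupNorm, ← ENNReal.ofReal_mul lpNorm_nonneg, ← ofReal_norm]
  gcongr
  rwa [← div_eq_mul_inv, le_div_iff₀ (norm_pos_iff.2 hx₀), mul_comm]

theorem bcsNonneg_of_lintegral_le {T μ : ℝ} {V : R3 → ℝ} (hT : 0 < T)
    (hV : AEStronglyMeasurable V volume)
    (h : ∀ ψ : Lp ℂ 2 (volume : Measure R3), ∫⁻ x, ‖V x‖ₑ * ‖ψ x‖ₑ ^ 2 ≤
      ∫⁻ ξ, ENNReal.ofReal (bcsSymbol T μ ((2 * Real.pi) • ξ)) *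
        ‖(𝓕 ψ : Lp ℂ 2 (volume : Measure R3)) ξ‖ₑ ^ 2) :
    BCSNonneg T μ V := by
  intro ψ hψ
  have hsymbol (p : R3) : 0 ≤ bcsSymbol T μ p :=
    (symbolMinorant_pos hT μ p).le.trans (symbolMinorant_le_bcsSymbol hT μ p)
  have hkinetic (ξ : R3) : 0 ≤ kineticDensity T μ ψ ξ := mul_nonneg (hsymbol _) (by positivity)
  have hbound : ∫⁻ x, ‖potentialDensity V ψ x‖ₑ ≤ ENNReal.ofReal (∫ ξ, kineticDensity T μ ψ ξ) := by
    rw [ofReal_integral_eq_lintegral_ofReal hψ (.of_forall hkinetic)]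
    simpa only [potentialDensity, kineticDensity, enorm_mul, enorm_pow, enorm_norm,
      ENNReal.ofReal_mul (hsymbol _), ENNReal.ofReal_pow (norm_nonneg _), ofReal_norm] using h ψ
  have hpotential : Integrable (potentialDensity V ψ) :=
    ⟨hV.mul ((Lp.aestronglyMeasurable ψ).norm.pow 2), hbound.trans_lt ENNReal.ofReal_lt_top⟩
  have habs : |∫ x, potentialDensity V ψ x| ≤ ∫ ξ, kineticDensity T μ ψ ξ := by
    rw [← Real.norm_eq_abs, ← ENNReal.ofReal_le_ofReal_iff (integral_nonneg hkinetic), ofReal_norm]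
    exact (enorm_integral_le_lintegral_enorm _).trans hbound
  exact ⟨hpotential, by linarith [neg_le_of_abs_le habs]⟩

/-- The exponent `C₂ μ^{1/4}` of the bound on the critical temperature. It is the value of
`log (μ / T) + 11` at which the constant of `lintegral_inv_norm_mul_enorm_sq_le` equals
`‖|·|V‖_∞⁻¹`. -/
noncomputable def pairingExponent (V : R3 → ℝ) (μ : ℝ) : ℝ :=
  √(Real.pi / (2 * weightedSupNorm V)) * μ ^ (1 / 4 : ℝ)

theorem pairingExponent_le_pairingExponent (V : R3 → ℝ) {μ ν : ℝ} (hμ : 0 ≤ μ) (hμν : μ ≤ ν) :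
    pairingExponent V μ ≤ pairingExponent V ν := by
  unfold pairingExponent
  gcongr

theorem tendsto_pairingExponent_atTop {V : R3 → ℝ} (hV : 0 < weightedSupNorm V) :
    Tendsto (pairingExponent V) atTop atTop :=
  (tendsto_rpow_atTop (by norm_num)).const_mul_atTop
    (Real.sqrt_pos.2 (div_pos Real.pi_pos (by positivity)))

theorem two_mul_sq_pairingExponent_div {V : R3 → ℝ} (hV : 0 < weightedSupNorm V) {μ : ℝ}
    (hμ : 0 < μ) :
    2 * pairingExponent V μ ^ 2 / (Real.pi * √μ) = (weightedSupNorm V)⁻¹ := by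
  have hpow : (μ ^ (1 / 4 : ℝ)) ^ 2 = √μ := by
    rw [← Real.rpow_mul_natCast hμ.le, Real.sqrt_eq_rpow]; norm_num
  have hsqrt : √μ ≠ 0 := (Real.sqrt_pos.2 hμ).ne'
  rw [pairingExponent, mul_pow, hpow, Real.sq_sqrt (by positivity)]
  have := Real.pi_ne_zero
  field_simp

theorem mem_normalTemperatures_of_symbolMinorant_le {V : R3 → ℝ}
    (hV : MemLp (fun x : R3 ↦ ‖x‖ * V x) ∞ volume) (hV₀ : 0 < weightedSupNorm V)
    {T μ T' ν : ℝ} (hT : 0 < T) (hT' : 0 < T') (hT'ν : T' ≤ ν)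
    (hν : Real.log (ν / T') + 11 ≤ pairingExponent V ν)
    (hle : ∀ p, symbolMinorant T' ν p ≤ symbolMinorant T μ p) :
    T ∈ normalTemperatures μ V := by
  have hlog : 0 ≤ Real.log (ν / T') := Real.log_nonneg ((one_le_div hT').2 hT'ν)
  set W := weightedSupNorm V
  refine ⟨hT, bcsNonneg_of_lintegral_le hT (aestronglyMeasurable_of_norm_mul hV.1) fun ψ ↦ ?_⟩
  calc ∫⁻ x, ‖V x‖ₑ * ‖ψ x‖ₑ ^ 2
      ≤ ENNReal.ofReal W * ∫⁻ x, ENNReal.ofReal ‖x‖⁻¹ * ‖ψ x‖ₑ ^ 2 :=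
        lintegral_enorm_mul_le_weightedSupNorm_mul hV _
    _ ≤ ENNReal.ofReal W * (ENNReal.ofReal W⁻¹ *
          ∫⁻ ξ, ENNReal.ofReal (symbolMinorant T' ν ((2 * Real.pi) • ξ)) *
            ‖(𝓕 ψ : Lp ℂ 2 (volume : Measure R3)) ξ‖ₑ ^ 2) := by
        rw [← two_mul_sq_pairingExponent_div hV₀ (hT'.trans_le hT'ν)]
        grw [lintegral_inv_norm_mul_enorm_sq_le hT' hT'ν ψ, hν]
    _ = ∫⁻ ξ, ENNReal.ofReal (symbolMinorant T' ν ((2 * Real.pi) • ξ)) *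
          ‖(𝓕 ψ : Lp ℂ 2 (volume : Measure R3)) ξ‖ₑ ^ 2 := by
        rw [← mul_assoc, ← ENNReal.ofReal_mul hV₀.le, mul_inv_cancel₀ hV₀.ne',
          ENNReal.ofReal_one, one_mul]
    _ ≤ _ := by
        gcongr with ξ
        exact (hle _).trans (symbolMinorant_le_bcsSymbol hT _ _)

theorem mem_normalTemperatures_of_exp_neg_pairingExponent_le {V : R3 → ℝ}
    (hV : MemLp (fun x : R3 ↦ ‖x‖ * V x) ∞ volume) (hV₀ : 0 < weightedSupNorm V) {T μ : ℝ}
    (hμ : 0 < μ) (hexp : 11 ≤ pairingExponent V μ)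
    (hT : Real.exp 11 * μ * Real.exp (-pairingExponent V μ) ≤ T) :
    T ∈ normalTemperatures μ V := by
  have hT' : 0 < Real.exp 11 * μ * Real.exp (-pairingExponent V μ) := by positivity
  have hratio : μ / (Real.exp 11 * μ * Real.exp (-pairingExponent V μ)) =
      Real.exp (pairingExponent V μ - 11) := by
    rw [Real.exp_sub, Real.exp_neg]
    field_simp
  refine mem_normalTemperatures_of_symbolMinorant_le hV hV₀ (hT'.trans_le hT) hT' ?_ ?_
    (symbolMinorant_le_symbolMinorant_of_le hT μ)
  · rw [← one_le_div hT', hratio, Real.one_le_exp_iff]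
    exact sub_nonneg.2 hexp
  · rw [hratio, Real.log_exp, sub_add_cancel]

theorem mem_normalTemperatures_of_le_of_le {V : R3 → ℝ}
    (hV : MemLp (fun x : R3 ↦ ‖x‖ * V x) ∞ volume) (hV₀ : 0 < weightedSupNorm V) {T μ ν : ℝ}
    (hν : 0 < ν) (hexp : 11 ≤ pairingExponent V ν) (hμν : μ ≤ ν) (hνT : ν ≤ T) :
    T ∈ normalTemperatures μ V :=
  mem_normalTemperatures_of_symbolMinorant_le hV hV₀ (hν.trans_le hνT) hν le_rfl
    (by rwa [div_self hν.ne', Real.log_one, zero_add])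
    (symbolMinorant_self_le_symbolMinorant hν.le hμν hνT)

end CriticalTemperature

theorem mainTheorem4 (V : R3 → ℝ)
    (hV : MemLp (fun x : R3 => ‖x‖ * V x) ∞ volume)
    (hV0 : ¬ V =ᵐ[volume] 0)
    (μ₀ : ℝ) (hμ₀ : 0 < μ₀) :
    ∃ C₁ : ℝ, 0 < C₁ ∧ ∀ μ : ℝ, μ₀ ≤ μ →
      (normalTemperatures μ V).Nonempty ∧
      criticalTemperature μ V ≤
        C₁ * μ * Real.exp (-(Real.sqrt (Real.pi / (2 * weightedSupNorm V)) * μ ^ (1 / 4 : ℝ))) := by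
  have hW := weightedSupNorm_pos hV hV0
  obtain ⟨μ₁, hexp, hμ₀₁⟩ := (((tendsto_pairingExponent_atTop hW).eventually_ge_atTop 11).and
    (eventually_ge_atTop μ₀)).exists
  have hμ₁ : 0 < μ₁ := hμ₀.trans_le hμ₀₁
  set C₁ := max (Real.exp 11) (μ₁ / μ₀ * Real.exp (pairingExponent V μ₁))
  refine ⟨C₁, lt_max_of_lt_left (Real.exp_pos _), fun μ hμ ↦ ?_⟩
  have hμ_pos : 0 < μ := hμ₀.trans_le hμ
  have hT : C₁ * μ * Real.exp (-pairingExponent V μ) ∈ normalTemperatures μ V := by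
    rcases le_total μ₁ μ with h | h
    · refine mem_normalTemperatures_of_exp_neg_pairingExponent_le hV hW hμ_pos
        (hexp.trans (pairingExponent_le_pairingExponent V hμ₁.le h)) ?_
      gcongr
      exact le_max_left _ _
    · refine mem_normalTemperatures_of_le_of_le hV hW hμ₁ hexp h ?_
      calc μ₁ = μ₁ / μ₀ * Real.exp (pairingExponent V μ₁) * μ₀ *
            Real.exp (-pairingExponent V μ₁) := by rw [Real.exp_neg]; field_simp
        _ ≤ C₁ * μ * Real.exp (-pairingExponent V μ) := by
          gcongr
          exacts [le_max_right _ _, pairingExponent_le_pairingExponent V hμ_pos.le h]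
  exact ⟨⟨_, hT⟩, csInf_le ⟨0, fun _ h ↦ h.1.le⟩ hT⟩
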